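/- Let $\langle a,b\rangle=-\tfrac12(a_1b_4-a_2b_3-a_3b_2+a_4b_1)$ on $M(2,\mathbb R)\cong\mathbb R^4$ (so that $\langle A,A\rangle=-\det A$), and let $\langle\cdot,\cdot\rangle$ also denote the corresponding product metric on $SL(2,\mathbb R)\times SL(2,\mathbb R)$. Tangent vectors at $(A,B)$ are the pairs $(A\alpha,B\beta)$ with $\alpha,\beta$ real $2\times2$ matrices of trace $0$. Put $$J(A\alpha,B\beta)=\tfrac1{\sqrt3}\bigl(A(\alpha-2\beta),B(2\alpha-\beta)\bigr),\qquad P(A\alpha,B\beta)=(A\beta,B\alpha),$$ $$g(Z,Z')=\tfrac23\langle Z,Z'\rangle-\tfrac13\langle PZ,Z'\rangle .$$ Let $M$ be a connected smooth two-dimensional manifold and let $F:M\to SL(2,\mathbb R)\times SL(2,\mathbb R)$ be a smooth immersion that is an almost complex surface, i.e. $J\,(dF(T_pM))=dF(T_pM)$ for all $p\in M$, and whose induced metric $F^*g$ is nondegenerate. Suppose that $F$ is totally geodesic, i.e. its second fundamental form with respect to the Levi-Civita connection of $g$ vanishes identically. Then one of the following holds. 1. At every point of $M$, $P$ maps the tangent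 space of the surface into its normal space (the $g$-orthogonal complement of $dF(T_pM)$ in the tangent space of $SL(2,\mathbb R)\times SL(2,\mathbb R)$), and the Gaussian curvature of the induced metric is $-\tfrac43$ at every point of $M$. 2. At every point of $M$, $P$ preserves the tangent space of the surface, and also its normal space, and the Gaussian curvature of the induced metric is $0$ at every point of $M$. -/

import Mathlib

open scoped Manifold ContDiff

noncomputable section

namespace NKSL

/-! ### The space `SL(2,ℝ) × SL(2,ℝ)` and its nearly Kähler structure -/

/-- The `2 × 2` real matrices. -/
abbrev Mat : Type := Matrix (Fin 2) (Fin 2) ℝ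

/-- The group `SL(2,ℝ)`. -/
abbrev SL : Type := Matrix.SpecialLinearGroup (Fin 2) ℝ

/-- The inclusion of `SL(2,ℝ) × SL(2,ℝ)` into the vector space of pairs of matrices. The smooth
structure of `SL(2,ℝ) × SL(2,ℝ)` is the one of a submanifold of this vector space. -/
def incl (q : SL × SL) : Mat × Mat := ((q.1 : Mat), (q.2 : Mat))

/-- Left translation `(α, β) ↦ (A α, B β)` for `q = (A, B)`. -/
def left (q : SL × SL) : (Mat × Mat) →ₗ[ℝ] (Mat × Mat) :=
  (LinearMap.mulLeft ℝ (q.1 : Mat)).prodMap (LinearMap.mulLeft ℝ (q.2 : Mat))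

/-- Left trivialization `(A α, B β) ↦ (α, β)` for `q = (A, B)`. -/
def triv (q : SL × SL) : (Mat × Mat) →ₗ[ℝ] (Mat × Mat) := left q⁻¹

@[simp] theorem left_triv (q : SL × SL) (Z : Mat × Mat) : left q (triv q Z) = Z := by
  have h1 : (q.1 : Mat) * ((q.1⁻¹ : SL) : Mat) = 1 := by
    rw [← Matrix.SpecialLinearGroup.coe_mul]; simp
  have h2 : (q.2 : Mat) * ((q.2⁻¹ : SL) : Mat) = 1 := by
    rw [← Matrix.SpecialLinearGroup.coe_mul]; simp
  ext1 <;> simp only [left, triv, LinearMap.prodMap_apply, LinearMap.mulLeft_apply, Prod.fst_inv,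
    Prod.snd_inv, ← mul_assoc, h1, h2, one_mul]

@[simp] theorem triv_left (q : SL × SL) (Z : Mat × Mat) : triv q (left q Z) = Z := by
  have h := left_triv q⁻¹ Z
  rwa [triv, inv_inv] at h

/-- The tangent space of `SL(2,ℝ) × SL(2,ℝ)` at `q = (A, B)`: all `(A α, B β)` with `α` and `β`
of trace zero. -/
def ambientTangent (q : SL × SL) : Submodule ℝ (Mat × Mat) where
  carrier := {Z | (triv q Z).1.trace = 0 ∧ (triv q Z).2.trace = 0}
  add_mem' := by
    rintro a b ⟨h1, h2⟩ ⟨h3, h4⟩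
    simp [h1, h2, h3, h4]
  zero_mem' := by simp
  smul_mem' := by
    rintro c a ⟨h1, h2⟩
    simp [h1, h2]

/-- The almost complex structure
`J (A α, B β) = (1 / √3) (A (α - 2 β), B (2 α - β))`. -/
def J (q : SL × SL) (Z : Mat × Mat) : Mat × Mat :=
  left q ((1 / √3 : ℝ) • ((triv q Z).1 - (2 : ℝ) • (triv q Z).2,
    (2 : ℝ) • (triv q Z).1 - (triv q Z).2))

/-- The almost product structure `P (A α, B β) = (A β, B α)`. -/
def P (q : SL × SL) (Z : Mat × Mat) : Mat × Mat :=
  left q ((triv q Z).2, (triv q Z).1)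

/-- The inner product `⟨a, b⟩ = -(1/2) (a₁ b₄ - a₂ b₃ - a₃ b₂ + a₄ b₁)` on `2 × 2` matrices. -/
def inner₀ (a b : Mat) : ℝ :=
  -(1 / 2) * (a 0 0 * b 1 1 - a 0 1 * b 1 0 - a 1 0 * b 0 1 + a 1 1 * b 0 0)

/-- The product metric `⟨(U, V), (U', V')⟩ = ⟨U, U'⟩ + ⟨V, V'⟩`. -/
def prodMetric (Z W : Mat × Mat) : ℝ := inner₀ Z.1 W.1 + inner₀ Z.2 W.2

/-- The nearly Kähler metric
`g((A α, B β), (A γ, B δ)) =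
  (2/3) ⟨(A α, B β), (A γ, B δ)⟩ - (1/3) ⟨(A β, B α), (A γ, B δ)⟩`. -/
def g (q : SL × SL) (Z W : Mat × Mat) : ℝ :=
  2 / 3 * prodMetric Z W - 1 / 3 * prodMetric (P q Z) W

/-! ### The Levi-Civita connection of `g` -/

/-- The product `α × β = (1/2) (α β - β α)`. -/
def cross (α β : Mat) : Mat := (1 / 2 : ℝ) • (α * β - β * α)

/-- The Levi-Civita connection of `g` on left invariant vector fields, in the left trivialization:
if `X`, `Y` are the left invariant fields `(A α, B β)` and `(A γ, B δ)`, with `ξ = (α, β)` and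
`η = (γ, δ)`, then `∇ X Y` is the left invariant field with value `conn ξ η` in the
trivialization. The lemmas `conn_torsion` and `conn_metric` below say that the
connection defined by `conn` is torsion free and metric. -/
def conn (ξ η : Mat × Mat) : Mat × Mat :=
  (cross ξ.1 η.1 - (1 / 3 : ℝ) • cross ξ.1 η.2 + (1 / 3 : ℝ) • cross ξ.2 η.1,
   cross ξ.2 η.2 + (1 / 3 : ℝ) • cross ξ.1 η.2 - (1 / 3 : ℝ) • cross ξ.2 η.1)

theorem conn_torsion (ξ η : Mat × Mat) :
    conn ξ η - conn η ξ = (ξ.1 * η.1 - η.1 * ξ.1, ξ.2 * η.2 - η.2 * ξ.2) := by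
  ext i j <;>
  · simp only [conn, cross, Prod.fst_sub, Prod.snd_sub, Matrix.sub_apply, Matrix.add_apply,
      Matrix.smul_apply, smul_eq_mul]
    ring

/-- `g` is left invariant, so it is constant on left invariant vector fields. -/
theorem g_left (q : SL × SL) (ξ η : Mat × Mat) : g q (left q ξ) (left q η) = g 1 ξ η := by
  have h1 := q.1.det_coe
  have h2 := q.2.det_coe
  rw [Matrix.det_fin_two] at h1 h2
  have key (A : SL) (a b : Mat) : inner₀ ((A : Mat) * a) ((A : Mat) * b) = inner₀ a b := by
    have h := A.det_coe
    rw [Matrix.det_fin_two] at h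
    have : inner₀ ((A : Mat) * a) ((A : Mat) * b) =
        (A.1 0 0 * A.1 1 1 - A.1 0 1 * A.1 1 0) * inner₀ a b := by
      simp only [inner₀, Matrix.mul_apply, Fin.sum_univ_two]
      ring
    rw [this, h, one_mul]
  have hl (Z : Mat × Mat) : left (1 : SL × SL) Z = Z := by simp [left]
  have ht (Z : Mat × Mat) : triv (1 : SL × SL) Z = Z := by simp [triv, hl]
  simp only [g, P, triv_left, prodMetric, ht, hl]
  simp only [left, LinearMap.prodMap_apply, LinearMap.mulLeft_apply, key]

theorem conn_metric (ζ ξ η : Mat × Mat) : g 1 (conn ζ ξ) η + g 1 ξ (conn ζ η) = 0 := by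
  have hl (Z : Mat × Mat) : left (1 : SL × SL) Z = Z := by simp [left]
  have ht (Z : Mat × Mat) : triv (1 : SL × SL) Z = Z := by simp [triv, hl]
  simp only [g, P, ht, hl, prodMetric, inner₀, conn, cross, Matrix.sub_apply, Matrix.add_apply,
    Matrix.smul_apply, smul_eq_mul, Matrix.mul_apply, Fin.sum_univ_two]
  ring

/-! ### Immersed surfaces -/

section Surface

variable {M : Type*} [TopologicalSpace M] [ChartedSpace (EuclideanSpace ℝ (Fin 2)) M]

/-- The derivative at `p` in direction `v` of a map from a surface to pairs of matrices, taken
entry by entry. -/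
def matDeriv (f : M → Mat × Mat) (p : M) (v : TangentSpace (𝓡 2) p) : Mat × Mat :=
  (Matrix.of fun i j => mfderiv (𝓡 2) 𝓘(ℝ, ℝ) (fun q => (f q).1 i j) p v,
   Matrix.of fun i j => mfderiv (𝓡 2) 𝓘(ℝ, ℝ) (fun q => (f q).2 i j) p v)

/-- The differential at `p` of a map `F : M → SL(2,ℝ) × SL(2,ℝ)`. -/
def dF (F : M → SL × SL) (p : M) (v : TangentSpace (𝓡 2) p) : Mat × Mat :=
  matDeriv (fun q => incl (F q)) p v

/-- The tangent space `dF(T_p M)` of the surface at `p`. -/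
def tangentPlane (F : M → SL × SL) (p : M) : Set (Mat × Mat) :=
  Set.range (dF F p)

/-- The normal space of the surface at `p`: the ambient tangent vectors that are `g`-orthogonal to
the tangent space of the surface. -/
def normalSpace (F : M → SL × SL) (p : M) : Set (Mat × Mat) :=
  {Z | Z ∈ ambientTangent (F p) ∧ ∀ W ∈ tangentPlane F p, g (F p) W Z = 0}

/-- An almost complex surface: a smooth immersion of a two dimensional manifold whose tangent
spaces are invariant under `J` and whose induced metric is nondegenerate. -/
structure IsAlmostComplexSurface (F : M → SL × SL) : Prop where
  smooth₁ : ∀ i j, ContMDiff (𝓡 2) 𝓘(ℝ, ℝ) ∞ (fun q => (incl (F q)).1 i j)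
  smooth₂ : ∀ i j, ContMDiff (𝓡 2) 𝓘(ℝ, ℝ) ∞ (fun q => (incl (F q)).2 i j)
  immersion : ∀ p, Function.Injective (dF F p)
  almostComplex : ∀ p, J (F p) '' tangentPlane F p = tangentPlane F p
  nondegenerate : ∀ p, ∀ v : TangentSpace (𝓡 2) p,
    (∀ w : TangentSpace (𝓡 2) p, g (F p) (dF F p v) (dF F p w) = 0) → v = 0

/-- The Levi-Civita covariant derivative, in direction `v ∈ T_p M`, of a vector field `W` along
`F`: writing `W` in the left invariant frame, differentiate the components and add the connection
term. -/
def covDeriv (F : M → SL × SL) (W : M → Mat × Mat) (p : M) (v : TangentSpace (𝓡 2) p) :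
    Mat × Mat :=
  left (F p) (matDeriv (fun q => triv (F q) (W q)) p v +
    conn (triv (F p) (dF F p v)) (triv (F p) (W p)))

/-- The surface is totally geodesic: its second fundamental form `h` vanishes, that is, for
every vector field `Y` on `M` that is smooth near `p` and every `v ∈ T_p M`, the ambient
derivative of `dF(Y)` in direction `v` has no normal component. -/
def IsTotallyGeodesic [IsManifold (𝓡 2) ∞ M] (F : M → SL × SL) : Prop :=
  ∀ (p : M) (Y : ∀ q : M, TangentSpace (𝓡 2) q),
    ContMDiffAt (𝓡 2) (𝓡 2).tangent ∞ (fun q => (⟨q, Y q⟩ : TangentBundle (𝓡 2) M)) p →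
    ∀ v : TangentSpace (𝓡 2) p, covDeriv F (fun q => dF F q (Y q)) p v ∈ tangentPlane F p

end Surface

/-! ### Gaussian curvature -/

/-- The `i`-th partial derivative. -/
def pd (i : Fin 2) (u : EuclideanSpace ℝ (Fin 2) → ℝ) (x : EuclideanSpace ℝ (Fin 2)) : ℝ :=
  fderiv ℝ u x (EuclideanSpace.single i 1)

/-- The Christoffel symbol `Γ^k_{ij}` of a metric tensor `G` given in coordinates. -/
def christoffel (G : EuclideanSpace ℝ (Fin 2) → Matrix (Fin 2) (Fin 2) ℝ) (k i j : Fin 2)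
    (x : EuclideanSpace ℝ (Fin 2)) : ℝ :=
  1 / 2 * ∑ l, (G x)⁻¹ k l *
    (pd i (fun y => G y j l) x + pd j (fun y => G y i l) x - pd l (fun y => G y i j) x)

/-- The component along `∂_l` of `R(∂_i, ∂_j) ∂_k`, where
`R(X, Y) Z = ∇_X ∇_Y Z - ∇_Y ∇_X Z - ∇_[X,Y] Z`. -/
def riemann (G : EuclideanSpace ℝ (Fin 2) → Matrix (Fin 2) (Fin 2) ℝ) (l i j k : Fin 2)
    (x : EuclideanSpace ℝ (Fin 2)) : ℝ :=
  pd i (christoffel G l j k) x - pd j (christoffel G l i k) x +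
    ∑ m, (christoffel G m j k x * christoffel G l i m x -
      christoffel G m i k x * christoffel G l j m x)

/-- The Gaussian curvature `K = g(R(∂₀, ∂₁) ∂₁, ∂₀) / (g₀₀ g₁₁ - g₀₁²)` of a metric tensor in
coordinates. -/
def coordCurvature (G : EuclideanSpace ℝ (Fin 2) → Matrix (Fin 2) (Fin 2) ℝ)
    (x : EuclideanSpace ℝ (Fin 2)) : ℝ :=
  (∑ l, riemann G l 0 1 1 x * G x l 0) / (G x).det

section Curvature

variable {M : Type*} [TopologicalSpace M] [ChartedSpace (EuclideanSpace ℝ (Fin 2)) M]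

/-- The `i`-th coordinate tangent vector `∂_i F` of the surface at the point with coordinates `x` in
the chart of `M` around `p`. -/
def coordTangent (F : M → SL × SL) (p : M) (i : Fin 2) (x : EuclideanSpace ℝ (Fin 2)) : Mat × Mat :=
  (Matrix.of fun a b => pd i (fun y => (incl (F ((extChartAt (𝓡 2) p).symm y))).1 a b) x,
   Matrix.of fun a b => pd i (fun y => (incl (F ((extChartAt (𝓡 2) p).symm y))).2 a b) x)

/-- The induced metric of the surface, in the chart of `M` around `p`. -/
def inducedMetric (F : M → SL × SL) (p : M) (x : EuclideanSpace ℝ (Fin 2)) :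
    Matrix (Fin 2) (Fin 2) ℝ :=
  Matrix.of fun i j =>
    g (F ((extChartAt (𝓡 2) p).symm x)) (coordTangent F p i x) (coordTangent F p j x)

/-- The Gaussian curvature of the induced metric at `p`. -/
def gaussianCurvature (F : M → SL × SL) (p : M) : ℝ :=
  coordCurvature (inducedMetric F p) (extChartAt (𝓡 2) p p)

end Curvature

end NKSL

end

open scoped Manifold ContDiff

noncomputable section

namespace NKSL

/-! Left invariance of `J`, `P`, `g` and the connection moves every pointwise question to the Lie
algebra. There a tangent plane becomes a complex line spanned by ξ and Jξ.

In a chart the frame ωᵢ = A⁻¹∂ᵢA satisfies the Maurer–Cartan equation. A vanishing second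
fundamental form says that ∂ᵢωⱼ + conn(ωᵢ, ωⱼ) lies in the span of ω₀, ω₁. Its coefficients must be
the Christoffel symbols of the induced metric (`christoffel_eq`), and commuting second derivatives
of the frame then gives the Gauss equation without second fundamental form (`curv_frame`). So the
ambient curvature preserves the tangent plane and restricts to the intrinsic curvature.

The explicit identity `curv_J_J` makes this a strong restriction. With m = g(Pξ, ξ) and n = g(JPξ,
ξ), invariance of the line forces mPξ + nJPξ into it. Hence either m = n = 0, so P sends the line to
its orthogonal complement, or Pξ lies in the line (`angle_eq_zero_or_swap_mem`). The same identity
gives K = 4/3·((m² + n²)/g(ξ, ξ)² − 1), which is −4/3 in the first case. In the second, P being an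
isometry gives m² + n² = g(ξ, ξ)², so K = 0.

These two values of m² + n² differ because g(ξ, ξ) ≠ 0, so the first type is an open and closed
condition (`isClopen_normal_type`); connectedness makes the type global. -/

/-- The almost complex structure in the left trivialization. -/
def J₁ (Z : Mat × Mat) : Mat × Mat :=
  (1 / √3 : ℝ) • (Z.1 - (2 : ℝ) • Z.2, (2 : ℝ) • Z.1 - Z.2)

/-- The curvature tensor of `g` in the left trivialization. -/
def curv (ξ η ζ : Mat × Mat) : Mat × Mat :=
  conn ξ (conn η ζ) - conn η (conn ξ ζ) - conn (ξ * η - η * ξ) ζ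

/-! ### The structure tensors at the identity -/

theorem left_one (Z : Mat × Mat) : left (1 : SL × SL) Z = Z := by simp [left]

theorem triv_one (Z : Mat × Mat) : triv (1 : SL × SL) Z = Z := by simp [triv, left_one]

theorem g_one (Z W : Mat × Mat) : g 1 Z W =
    2 / 3 * (inner₀ Z.1 W.1 + inner₀ Z.2 W.2) - 1 / 3 * (inner₀ Z.2 W.1 + inner₀ Z.1 W.2) := by
  simp [g, P, prodMetric, triv_one, left_one]

theorem J_left (q : SL × SL) (Z : Mat × Mat) : J q (left q Z) = left q (J₁ Z) := by
  simp [J, J₁]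

theorem P_left (q : SL × SL) (Z : Mat × Mat) : P q (left q Z) = left q Z.swap := by
  simp [P, Prod.swap]

theorem inv_sqrt_three_sq : (1 / √3 : ℝ) ^ 2 = 1 / 3 := by
  rw [div_pow, Real.sq_sqrt] <;> norm_num

/-! ### Coordinates on trace zero pairs and the curvature identities -/

/-- The pair of trace zero matrices with the given entries. -/
def pairOf (a b c d e f : ℝ) : Mat × Mat := (!![a, b; c, -a], !![d, e; f, -d])

theorem exists_pairOf (ξ : Mat × Mat) (h₁ : ξ.1.trace = 0) (h₂ : ξ.2.trace = 0) :
    ∃ a b c d e f, ξ = pairOf a b c d e f := by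
  rw [Matrix.trace_fin_two] at h₁ h₂
  refine ⟨ξ.1 0 0, ξ.1 0 1, ξ.1 1 0, ξ.2 0 0, ξ.2 0 1, ξ.2 1 0, ?_⟩
  have h₁' : ξ.1 1 1 = -ξ.1 0 0 := by linarith
  have h₂' : ξ.2 1 1 = -ξ.2 0 0 := by linarith
  ext i j <;> fin_cases i <;> fin_cases j <;> simp [pairOf, h₁', h₂']

theorem cross_explicit (a b c d e f : ℝ) : cross !![a, b; c, -a] !![d, e; f, -d] =
    !![(b * f - c * e) / 2, a * e - b * d; c * d - a * f, -((b * f - c * e) / 2)] := by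
  ext i j <;> fin_cases i <;> fin_cases j
  all_goals simp [cross]; ring

theorem conn_pairOf (a b c d e f a' b' c' d' e' f' : ℝ) :
    conn (pairOf a b c d e f) (pairOf a' b' c' d' e' f') = pairOf
      ((b * c' - c * b') / 2 - (b * f' - c * e') / 6 + (e * c' - f * b') / 6)
      ((a * b' - b * a') - (a * e' - b * d') / 3 + (d * b' - e * a') / 3)
      ((c * a' - a * c') - (c * d' - a * f') / 3 + (f * a' - d * c') / 3)
      ((e * f' - f * e') / 2 + (b * f' - c * e') / 6 - (e * c' - f * b') / 6)
      ((d * e' - e * d') + (a * e' - b * d') / 3 - (d * b' - e * a') / 3)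
      ((f * d' - d * f') + (c * d' - a * f') / 3 - (f * a' - d * c') / 3) := by
  simp only [conn, pairOf, cross_explicit]
  ext i j <;> fin_cases i <;> fin_cases j <;> simp <;> ring

theorem bracket_pairOf (a b c d e f a' b' c' d' e' f' : ℝ) :
    pairOf a b c d e f * pairOf a' b' c' d' e' f' - pairOf a' b' c' d' e' f' * pairOf a b c d e f =
    pairOf (b * c' - c * b') (2 * (a * b' - b * a')) (2 * (c * a' - a * c'))
      (e * f' - f * e') (2 * (d * e' - e * d')) (2 * (f * d' - d * f')) := by
  ext i j <;> fin_cases i <;> fin_cases j <;>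
    simp [pairOf] <;> ring

theorem pairOf_add (a b c d e f a' b' c' d' e' f' : ℝ) :
    pairOf a b c d e f + pairOf a' b' c' d' e' f' =
    pairOf (a + a') (b + b') (c + c') (d + d') (e + e') (f + f') := by
  ext i j <;> fin_cases i <;> fin_cases j <;> simp [pairOf] <;> ring

theorem pairOf_sub (a b c d e f a' b' c' d' e' f' : ℝ) :
    pairOf a b c d e f - pairOf a' b' c' d' e' f' =
    pairOf (a - a') (b - b') (c - c') (d - d') (e - e') (f - f') := by
  ext i j <;> fin_cases i <;> fin_cases j <;> simp [pairOf] <;> ring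

theorem smul_pairOf (r a b c d e f : ℝ) :
    r • pairOf a b c d e f = pairOf (r * a) (r * b) (r * c) (r * d) (r * e) (r * f) := by
  ext i j <;> fin_cases i <;> fin_cases j <;> simp [pairOf]

theorem J₁_pairOf (a b c d e f : ℝ) : J₁ (pairOf a b c d e f) = (1 / √3 : ℝ) •
    pairOf (a - 2 * d) (b - 2 * e) (c - 2 * f) (2 * a - d) (2 * b - e) (2 * c - f) := by
  simp only [J₁]
  congr 1
  ext i j <;> fin_cases i <;> fin_cases j <;> simp [pairOf] <;> ring

theorem swap_pairOf (a b c d e f : ℝ) : (pairOf a b c d e f).swap = pairOf d e f a b c := rfl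

theorem g_one_pairOf (a b c d e f a' b' c' d' e' f' : ℝ) :
    g 1 (pairOf a b c d e f) (pairOf a' b' c' d' e' f') =
    2 / 3 * (a * a' + (b * c' + c * b') / 2 + d * d' + (e * f' + f * e') / 2) -
    1 / 3 * (d * a' + (e * c' + f * b') / 2 + a * d' + (b * f' + c * e') / 2) := by
  simp [g_one, inner₀, pairOf]; ring

/-- A polynomial identity in the six entries of ξ. The last two terms measure how far the geometry
is from constant holomorphic sectional curvature, and they are what forces the dichotomy for P. -/
theorem curv_J_J (ξ : Mat × Mat) (h₁ : ξ.1.trace = 0) (h₂ : ξ.2.trace = 0) :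
    curv ξ (J₁ ξ) (J₁ ξ) = (4 / 3 : ℝ) • (-(g 1 ξ ξ) • ξ + g 1 ξ.swap ξ • ξ.swap +
      g 1 (J₁ ξ.swap) ξ • J₁ ξ.swap) := by
  have hs := inv_sqrt_three_sq
  obtain ⟨a, b, c, d, e, f, rfl⟩ := exists_pairOf ξ h₁ h₂
  simp only [J₁_pairOf, swap_pairOf]
  generalize (1 / √3 : ℝ) = s at hs ⊢
  -- With s = 1/√3, the left side and the last term are quadratic in s while the other two are free
  -- of it. Inserting 3s² = 1 there makes the identity homogeneous in s, so it holds for a free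
  -- variable s.
  have h (x : Mat × Mat) : x = (3 * s ^ 2) • x := by rw [hs]; norm_num
  rw [h (-(g 1 (pairOf a b c d e f) (pairOf a b c d e f)) • pairOf a b c d e f +
    g 1 (pairOf d e f a b c) (pairOf a b c d e f) • pairOf d e f a b c)]
  simp only [curv, g_one_pairOf, smul_pairOf, conn_pairOf, bracket_pairOf, pairOf_sub, pairOf_add]
  congr 1 <;> ring

/-- Every term is linear in 1/√3, so the value of that constant plays no role. -/
theorem curv_J (ξ : Mat × Mat) (h₁ : ξ.1.trace = 0) (h₂ : ξ.2.trace = 0) :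
    curv ξ (J₁ ξ) ξ = (4 / 3 : ℝ) • (g 1 ξ ξ • J₁ ξ - g 1 ξ.swap ξ • J₁ ξ.swap +
      g 1 (J₁ ξ.swap) ξ • ξ.swap) := by
  obtain ⟨a, b, c, d, e, f, rfl⟩ := exists_pairOf ξ h₁ h₂
  simp only [J₁_pairOf, swap_pairOf, curv, g_one_pairOf, smul_pairOf, conn_pairOf, bracket_pairOf,
    pairOf_sub, pairOf_add]
  congr 1 <;> ring

/-! ### Compatibility of J, P and g -/

theorem J₁_J₁ (ξ : Mat × Mat) : J₁ (J₁ ξ) = -ξ := by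
  have hs := inv_sqrt_three_sq
  simp only [J₁]
  generalize (1 / √3 : ℝ) = s at hs ⊢
  ext i j <;> simp
  · linear_combination (-3 * ξ.1 i j) * hs
  · linear_combination (-3 * ξ.2 i j) * hs

theorem J₁_swap (ξ : Mat × Mat) : J₁ ξ.swap = -(J₁ ξ).swap := by
  simp only [J₁]
  ext i j <;> simp <;> ring

theorem J₁_add (ξ η : Mat × Mat) : J₁ (ξ + η) = J₁ ξ + J₁ η := by
  simp only [J₁]
  ext i j <;> simp <;> ring

theorem J₁_smul (r : ℝ) (ξ : Mat × Mat) : J₁ (r • ξ) = r • J₁ ξ := by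
  simp only [J₁]
  ext i j <;> simp <;> ring

theorem g_comm (ξ η : Mat × Mat) : g 1 ξ η = g 1 η ξ := by
  simp only [g_one, inner₀]; ring

theorem g_add_left (ξ η ζ : Mat × Mat) : g 1 (ξ + η) ζ = g 1 ξ ζ + g 1 η ζ := by
  simp [g_one, inner₀]; ring

theorem g_smul_left (r : ℝ) (ξ ζ : Mat × Mat) : g 1 (r • ξ) ζ = r * g 1 ξ ζ := by
  simp [g_one, inner₀]; ring

theorem g_add_right (ξ η ζ : Mat × Mat) : g 1 ζ (ξ + η) = g 1 ζ ξ + g 1 ζ η := by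
  simp [g_one, inner₀]; ring

theorem g_smul_right (r : ℝ) (ξ ζ : Mat × Mat) : g 1 ζ (r • ξ) = r * g 1 ζ ξ := by
  simp [g_one, inner₀]; ring

theorem g_swap_swap (ξ η : Mat × Mat) : g 1 ξ.swap η.swap = g 1 ξ η := by
  simp [g_one]; ring

theorem g_swap_left (ξ η : Mat × Mat) : g 1 ξ.swap η = g 1 ξ η.swap := by
  simp [g_one]; ring

theorem g_J₁_J₁ (ξ η : Mat × Mat) : g 1 (J₁ ξ) (J₁ η) = g 1 ξ η := by
  have hs := inv_sqrt_three_sq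
  simp only [J₁]
  generalize (1 / √3 : ℝ) = s at hs ⊢
  rw [g_smul_left, g_smul_right, ← mul_assoc, ← sq, hs]
  simp [g_one, inner₀]; ring

theorem g_J₁_left (ξ η : Mat × Mat) : g 1 (J₁ ξ) η = -g 1 ξ (J₁ η) := by
  rw [← g_J₁_J₁ (J₁ ξ), J₁_J₁, ← neg_one_smul ℝ, g_smul_left]; ring

theorem g_J₁_self (ξ : Mat × Mat) : g 1 (J₁ ξ) ξ = 0 := by
  have h := g_J₁_left ξ ξ
  rw [g_comm ξ] at h; linarith

/-! ### Linearity of the connection and the curvature -/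

theorem cross_add_left (a b c : Mat) : cross (a + b) c = cross a c + cross b c := by
  simp only [cross, add_mul, mul_add]; module

theorem cross_add_right (a b c : Mat) : cross c (a + b) = cross c a + cross c b := by
  simp only [cross, add_mul, mul_add]; module

theorem cross_smul_left (r : ℝ) (a b : Mat) : cross (r • a) b = r • cross a b := by
  simp only [cross, smul_mul_assoc, mul_smul_comm]; module

theorem cross_smul_right (r : ℝ) (a b : Mat) : cross a (r • b) = r • cross a b := by
  simp only [cross, smul_mul_assoc, mul_smul_comm]; module

theorem conn_add_left (ξ η ζ : Mat × Mat) : conn (ξ + η) ζ = conn ξ ζ + conn η ζ := by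
  ext1 <;> simp only [conn, Prod.fst_add, Prod.snd_add, cross_add_left] <;> module

theorem conn_add_right (ξ η ζ : Mat × Mat) : conn ζ (ξ + η) = conn ζ ξ + conn ζ η := by
  ext1 <;> simp only [conn, Prod.fst_add, Prod.snd_add, cross_add_right] <;> module

theorem conn_smul_left (r : ℝ) (ξ η : Mat × Mat) : conn (r • ξ) η = r • conn ξ η := by
  ext1 <;> simp only [conn, Prod.smul_fst, Prod.smul_snd, cross_smul_left] <;> module

theorem conn_smul_right (r : ℝ) (ξ η : Mat × Mat) : conn ξ (r • η) = r • conn ξ η := by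
  ext1 <;> simp only [conn, Prod.smul_fst, Prod.smul_snd, cross_smul_right] <;> module

theorem conn_sub_left (ξ η ζ : Mat × Mat) : conn (ξ - η) ζ = conn ξ ζ - conn η ζ := by
  rw [sub_eq_add_neg, ← neg_one_smul ℝ η, conn_add_left, conn_smul_left]; module

theorem conn_sub_right (ξ η ζ : Mat × Mat) : conn ζ (ξ - η) = conn ζ ξ - conn ζ η := by
  rw [sub_eq_add_neg, ← neg_one_smul ℝ η, conn_add_right, conn_smul_right]; module

theorem curv_comb_middle (r s : ℝ) (ξ η ζ : Mat × Mat) :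
    curv ξ (r • ξ + s • η) ζ = s • curv ξ η ζ := by
  simp only [curv, mul_add, add_mul, smul_mul_assoc, mul_smul_comm, add_sub_add_comm, sub_self,
    zero_add, ← smul_sub, conn_add_left, conn_add_right, conn_smul_left, conn_smul_right]

theorem curv_add_right (ξ η ζ ζ' : Mat × Mat) :
    curv ξ η (ζ + ζ') = curv ξ η ζ + curv ξ η ζ' := by
  simp only [curv, conn_add_right]; module

theorem curv_smul_right (r : ℝ) (ξ η ζ : Mat × Mat) : curv ξ η (r • ζ) = r • curv ξ η ζ := by
  simp only [curv, conn_smul_right]; module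

/-! ### Complex lines in the trivialized tangent space -/

/-- The `J`-invariant real plane spanned by `ξ` and `J ξ`. -/
def complexLine (ξ : Mat × Mat) : Submodule ℝ (Mat × Mat) := Submodule.span ℝ {ξ, J₁ ξ}

theorem mem_complexLine {ξ η : Mat × Mat} :
    η ∈ complexLine ξ ↔ ∃ a b : ℝ, a • ξ + b • J₁ ξ = η := Submodule.mem_span_pair

theorem J₁_mem_complexLine {ξ η : Mat × Mat} (h : η ∈ complexLine ξ) :
    J₁ η ∈ complexLine ξ := by
  obtain ⟨a, b, rfl⟩ := mem_complexLine.1 h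
  refine mem_complexLine.2 ⟨-b, a, ?_⟩
  rw [J₁_add, J₁_smul, J₁_smul, J₁_J₁]; module

/-- Since PJ = −JP, the condition on the generator ξ alone suffices. -/
theorem swap_mem_complexLine {ξ η : Mat × Mat} (hξ : ξ.swap ∈ complexLine ξ)
    (h : η ∈ complexLine ξ) : η.swap ∈ complexLine ξ := by
  obtain ⟨a, b, rfl⟩ := mem_complexLine.1 h
  have e : (a • ξ + b • J₁ ξ).swap = a • ξ.swap - b • J₁ ξ.swap := by
    rw [J₁_swap]
    ext <;> simp
  rw [e]
  exact sub_mem (Submodule.smul_mem _ _ hξ) (Submodule.smul_mem _ _ (J₁_mem_complexLine hξ))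

theorem exists_eq_of_J₁_mem_span {ξ η : Mat × Mat} (hξ : ξ ≠ 0)
    (h : J₁ ξ ∈ Submodule.span ℝ {ξ, η}) : ∃ a b : ℝ, b ≠ 0 ∧ η = a • ξ + b • J₁ ξ := by
  obtain ⟨x, y, h⟩ := Submodule.mem_span_pair.1 h
  -- Otherwise ξ would be a real eigenvector of J, whose eigenvalue x would satisfy x² = −1.
  have hy : y ≠ 0 := by
    rintro rfl
    rw [zero_smul, add_zero] at h
    have h2 := congrArg J₁ h
    rw [J₁_smul, J₁_J₁, ← h] at h2
    have h3 : (x * x + 1) • ξ = 0 := by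
      have : (x * x + 1) • ξ = x • x • ξ + ξ := by module
      rw [this, h2, neg_add_cancel]
    rcases smul_eq_zero.1 h3 with h3 | h3
    · nlinarith
    · exact hξ h3
  refine ⟨-(y⁻¹ * x), y⁻¹, inv_ne_zero hy, ?_⟩
  rw [← h, smul_add, smul_smul y⁻¹ y, inv_mul_cancel₀ hy]
  module

theorem span_pair_eq_complexLine {ξ η : Mat × Mat} {a b : ℝ} (hb : b ≠ 0)
    (h : η = a • ξ + b • J₁ ξ) : Submodule.span ℝ {ξ, η} = complexLine ξ := by
  apply le_antisymm
  · rw [Submodule.span_le]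
    rintro z (rfl | rfl)
    · exact mem_complexLine.2 ⟨1, 0, by module⟩
    · exact mem_complexLine.2 ⟨a, b, h.symm⟩
  · rw [complexLine, Submodule.span_le]
    rintro z (rfl | rfl)
    · exact Submodule.mem_span_pair.2 ⟨1, 0, by module⟩
    · refine Submodule.mem_span_pair.2 ⟨-(b⁻¹ * a), b⁻¹, ?_⟩
      rw [h, smul_add, smul_smul b⁻¹ b, inv_mul_cancel₀ hb]
      module

/-- The squared `g`-size of the component of `P ξ` in the complex line of `ξ`. -/
def angle (ξ : Mat × Mat) : ℝ := g 1 ξ.swap ξ ^ 2 + g 1 (J₁ ξ.swap) ξ ^ 2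

theorem angle_eq_zero_iff {ξ : Mat × Mat} :
    angle ξ = 0 ↔ g 1 ξ.swap ξ = 0 ∧ g 1 ξ.swap (J₁ ξ) = 0 := by
  rw [angle, g_J₁_left]
  constructor
  · intro h
    constructor <;> nlinarith [sq_nonneg (g 1 ξ.swap ξ), sq_nonneg (g 1 ξ.swap (J₁ ξ))]
  · rintro ⟨h₁, h₂⟩
    rw [h₁, h₂]; norm_num

/-- If Pξ = aξ + bJξ, then the angle is (a² + b²)g(ξ, ξ)², and P being an isometry gives (a² +
b²)g(ξ, ξ) = g(ξ, ξ). -/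
theorem angle_eq_sq {ξ : Mat × Mat} (h : ξ.swap ∈ complexLine ξ) : angle ξ = g 1 ξ ξ ^ 2 := by
  obtain ⟨a, b, h⟩ := mem_complexLine.1 h
  have h0 := g_swap_swap ξ ξ
  have e : g 1 ξ (J₁ ξ) = 0 := by rw [g_comm, g_J₁_self]
  rw [angle, ← h, J₁_add, J₁_smul, J₁_smul, J₁_J₁, ← neg_one_smul ℝ ξ]
  rw [← h] at h0
  simp only [g_add_left, g_add_right, g_smul_left, g_smul_right, g_J₁_J₁, g_J₁_self, e] at h0 ⊢
  linear_combination (g 1 ξ ξ) * h0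

/-- If the curvature tensor preserves the complex line of `ξ`, then `P` maps it to itself or to its
orthogonal complement. -/
theorem angle_eq_zero_or_swap_mem {ξ : Mat × Mat} (h₁ : ξ.1.trace = 0) (h₂ : ξ.2.trace = 0)
    (h : curv ξ (J₁ ξ) (J₁ ξ) ∈ complexLine ξ) : angle ξ = 0 ∨ ξ.swap ∈ complexLine ξ := by
  rw [or_iff_not_imp_left]
  intro hn
  set m := g 1 ξ.swap ξ with hm
  set n := g 1 (J₁ ξ.swap) ξ with hn'
  have hξ : ξ ∈ complexLine ξ := mem_complexLine.2 ⟨1, 0, by module⟩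
  -- Solve `curv_J_J` for this combination; every other term lies in the line.
  have hv : m • ξ.swap + n • J₁ ξ.swap ∈ complexLine ξ := by
    have e : m • ξ.swap + n • J₁ ξ.swap =
        (3 / 4 : ℝ) • curv ξ (J₁ ξ) (J₁ ξ) + g 1 ξ ξ • ξ := by
      rw [curv_J_J ξ h₁ h₂]; module
    rw [e]
    exact add_mem (Submodule.smul_mem _ _ h) (Submodule.smul_mem _ _ hξ)
  -- Multiplying by the conjugate: (m − nJ)(m + nJ) = m² + n², which is nonzero by assumption.
  have hw := sub_mem (Submodule.smul_mem _ m hv)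
    (Submodule.smul_mem _ n (J₁_mem_complexLine hv))
  have e : m • (m • ξ.swap + n • J₁ ξ.swap) - n • J₁ (m • ξ.swap + n • J₁ ξ.swap) =
      angle ξ • ξ.swap := by
    rw [J₁_add, J₁_smul, J₁_smul, J₁_J₁, angle, ← hm, ← hn']; module
  rw [e] at hw
  exact (Submodule.smul_mem_iff _ hn).1 hw

/-- The numerator of the sectional curvature. The a-part contributes nothing, because the two
P-terms of `curv_J` cancel when paired with ξ. The denominator is `gram_eq`, and the factor b² drops
out of the quotient. -/
theorem curv_eq_angle {ξ η : Mat × Mat} (h₁ : ξ.1.trace = 0) (h₂ : ξ.2.trace = 0) {a b : ℝ}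
    (h : η = a • ξ + b • J₁ ξ) :
    g 1 (curv ξ η η) ξ = b ^ 2 * (4 / 3 * (angle ξ - g 1 ξ ξ ^ 2)) := by
  subst h
  rw [curv_comb_middle, curv_add_right, curv_smul_right, curv_smul_right, curv_J_J ξ h₁ h₂,
    curv_J ξ h₁ h₂, sub_eq_add_neg, ← neg_one_smul ℝ (g 1 ξ.swap ξ • J₁ ξ.swap)]
  simp only [g_add_left, g_smul_left, g_J₁_self, angle]
  ring

theorem gram_eq {ξ η : Mat × Mat} {a b : ℝ} (h : η = a • ξ + b • J₁ ξ) :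
    g 1 ξ ξ * g 1 η η - g 1 ξ η * g 1 η ξ = b ^ 2 * g 1 ξ ξ ^ 2 := by
  subst h
  have e : g 1 ξ (J₁ ξ) = 0 := by rw [g_comm, g_J₁_self]
  simp only [g_add_left, g_add_right, g_smul_left, g_smul_right, g_J₁_J₁, g_J₁_self, e]
  ring

theorem curv_mem_complexLine {ξ η : Mat × Mat} {a b : ℝ} (hb : b ≠ 0)
    (h : η = a • ξ + b • J₁ ξ) (hc₁ : curv ξ η ξ ∈ complexLine ξ)
    (hc₂ : curv ξ η η ∈ complexLine ξ) : curv ξ (J₁ ξ) (J₁ ξ) ∈ complexLine ξ := by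
  subst h
  rw [curv_comb_middle] at hc₁ hc₂
  have h₁ := (Submodule.smul_mem_iff _ hb).1 hc₁
  have h₂ := (Submodule.smul_mem_iff _ hb).1 hc₂
  rw [curv_add_right, curv_smul_right, curv_smul_right,
    Submodule.add_mem_iff_right _ (Submodule.smul_mem _ _ h₁)] at h₂
  exact (Submodule.smul_mem_iff _ hb).1 h₂

/-- Vanishing angle gives Pξ ⟂ ξ and Pξ ⟂ Jξ; self-adjointness of P and PJ = −JP supply the same for
PJξ. -/
theorem g_swap_eq_zero {ξ : Mat × Mat} (h : angle ξ = 0) {u v : Mat × Mat}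
    (hu : u ∈ complexLine ξ) (hv : v ∈ complexLine ξ) : g 1 u.swap v = 0 := by
  obtain ⟨h₁, h₂⟩ := angle_eq_zero_iff.1 h
  obtain ⟨a, b, rfl⟩ := mem_complexLine.1 hu
  obtain ⟨c, d, rfl⟩ := mem_complexLine.1 hv
  have h₃ : g 1 (J₁ ξ).swap ξ = 0 := by rw [g_swap_left, g_comm, h₂]
  have h₄ : g 1 (J₁ ξ).swap (J₁ ξ) = 0 := by
    rw [← neg_neg (J₁ ξ).swap, ← J₁_swap, ← neg_one_smul ℝ, g_smul_left, g_J₁_J₁, h₁, mul_zero]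
  rw [show (a • ξ + b • J₁ ξ).swap = a • ξ.swap + b • (J₁ ξ).swap from rfl]
  simp only [g_add_left, g_add_right, g_smul_left, g_smul_right,
    h₁, h₂, h₃, h₄]
  ring

/-! ### Calculus of maps into pairs of matrices -/

/-- The coordinate plane. -/
abbrev Plane : Type := EuclideanSpace ℝ (Fin 2)

/-- Smoothness at a point of all entries. -/
def EntrySmooth (W : Plane → Mat × Mat) (x : Plane) : Prop :=
  (∀ a b, ContDiffAt ℝ ∞ (fun y => (W y).1 a b) x) ∧ ∀ a b, ContDiffAt ℝ ∞ (fun y => (W y).2 a b) x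

/-- The `i`-th partial derivative of a map into pairs of matrices, entry by entry. -/
def pdm (i : Fin 2) (W : Plane → Mat × Mat) (x : Plane) : Mat × Mat :=
  (Matrix.of fun a b => pd i (fun y => (W y).1 a b) x,
   Matrix.of fun a b => pd i (fun y => (W y).2 a b) x)

theorem pd_congr {i : Fin 2} {u v : Plane → ℝ} {x : Plane} (h : u =ᶠ[nhds x] v) :
    pd i u x = pd i v x := by
  rw [pd, pd, h.fderiv_eq]

theorem pd_add {i : Fin 2} {u v : Plane → ℝ} {x : Plane} (hu : DifferentiableAt ℝ u x)
    (hv : DifferentiableAt ℝ v x) : pd i (fun y => u y + v y) x = pd i u x + pd i v x := by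
  rw [pd, fderiv_fun_add hu hv]; rfl

theorem pd_sub {i : Fin 2} {u v : Plane → ℝ} {x : Plane} (hu : DifferentiableAt ℝ u x)
    (hv : DifferentiableAt ℝ v x) : pd i (fun y => u y - v y) x = pd i u x - pd i v x := by
  rw [pd, fderiv_fun_sub hu hv]; rfl

theorem pd_mul {i : Fin 2} {u v : Plane → ℝ} {x : Plane} (hu : DifferentiableAt ℝ u x)
    (hv : DifferentiableAt ℝ v x) :
    pd i (fun y => u y * v y) x = pd i u x * v x + u x * pd i v x := by
  rw [pd, fderiv_fun_mul hu hv]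
  simp only [add_apply, smul_apply, smul_eq_mul, pd]
  ring

theorem pd_const_mul {i : Fin 2} (r : ℝ) {v : Plane → ℝ} {x : Plane}
    (hv : DifferentiableAt ℝ v x) : pd i (fun y => r * v y) x = r * pd i v x := by
  rw [pd, fderiv_const_mul hv]; rfl

theorem contDiffAt_pd {i : Fin 2} {u : Plane → ℝ} {x : Plane} (hu : ContDiffAt ℝ ∞ u x) :
    ContDiffAt ℝ ∞ (pd i u) x :=
  (hu.fderiv_right (m := ∞) (by simp)).clm_apply contDiffAt_const

theorem pd_comm {i j : Fin 2} {u : Plane → ℝ} {x : Plane} (hu : ContDiffAt ℝ ∞ u x) :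
    pd i (pd j u) x = pd j (pd i u) x := by
  have hd : DifferentiableAt ℝ (fderiv ℝ u) x :=
    (hu.fderiv_right (m := ∞) (by simp)).differentiableAt (by simp)
  have key (k l : Fin 2) : pd k (pd l u) x =
      fderiv ℝ (fderiv ℝ u) x (EuclideanSpace.single k 1) (EuclideanSpace.single l 1) := by
    have e : pd l u = fun y => fderiv ℝ u y (EuclideanSpace.single l 1) := rfl
    rw [e, pd, fderiv_clm_apply hd (differentiableAt_const _)]
    simp
  rw [key, key]
  exact hu.isSymmSndFDerivAt (by
    rw [minSmoothness_of_isRCLikeNormedField]; exact WithTop.coe_le_coe.2 le_top) _ _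

section Calculus

variable {W W' : Plane → Mat × Mat} {x : Plane} {i j : Fin 2}

theorem EntrySmooth.fst (h : EntrySmooth W x) (a b : Fin 2) :
    DifferentiableAt ℝ (fun y => (W y).1 a b) x := (h.1 a b).differentiableAt (by simp)

theorem EntrySmooth.snd (h : EntrySmooth W x) (a b : Fin 2) :
    DifferentiableAt ℝ (fun y => (W y).2 a b) x := (h.2 a b).differentiableAt (by simp)

theorem EntrySmooth.pdm (h : EntrySmooth W x) : EntrySmooth (pdm i W) x :=
  ⟨fun a b => contDiffAt_pd (h.1 a b), fun a b => contDiffAt_pd (h.2 a b)⟩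

theorem EntrySmooth.mul (h : EntrySmooth W x) (h' : EntrySmooth W' x) :
    EntrySmooth (fun y => W y * W' y) x := by
  constructor <;> intro a b
  · simp only [Prod.fst_mul, Matrix.mul_apply, Fin.sum_univ_two]
    exact ((h.1 _ _).mul (h'.1 _ _)).add ((h.1 _ _).mul (h'.1 _ _))
  · simp only [Prod.snd_mul, Matrix.mul_apply, Fin.sum_univ_two]
    exact ((h.2 _ _).mul (h'.2 _ _)).add ((h.2 _ _).mul (h'.2 _ _))

theorem pdm_congr (h : W =ᶠ[nhds x] W') : pdm i W x = pdm i W' x := by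
  have h1 (a b) : pd i (fun y => (W y).1 a b) x = pd i (fun y => (W' y).1 a b) x :=
    pd_congr (h.mono fun y hy => by simp only [hy])
  have h2 (a b) : pd i (fun y => (W y).2 a b) x = pd i (fun y => (W' y).2 a b) x :=
    pd_congr (h.mono fun y hy => by simp only [hy])
  simp only [pdm, h1, h2]

theorem pdm_comm (h : EntrySmooth W x) : pdm i (pdm j W) x = pdm j (pdm i W) x := by
  ext a b
  · exact pd_comm (h.1 a b)
  · exact pd_comm (h.2 a b)

theorem pdm_mul (h : EntrySmooth W x) (h' : EntrySmooth W' x) :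
    pdm i (fun y => W y * W' y) x = pdm i W x * W' x + W x * pdm i W' x := by
  ext a b
  · simp only [pdm, Prod.fst_mul, Prod.fst_add, Matrix.add_apply, Matrix.mul_apply,
      Fin.sum_univ_two, Matrix.of_apply]
    rw [pd_add ((h.fst _ _).fun_mul (h'.fst _ _)) ((h.fst _ _).fun_mul (h'.fst _ _)),
      pd_mul (h.fst _ _) (h'.fst _ _), pd_mul (h.fst _ _) (h'.fst _ _)]
    ring
  · simp only [pdm, Prod.snd_mul, Prod.snd_add, Matrix.add_apply, Matrix.mul_apply,
      Fin.sum_univ_two, Matrix.of_apply]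
    rw [pd_add ((h.snd _ _).fun_mul (h'.snd _ _)) ((h.snd _ _).fun_mul (h'.snd _ _)),
      pd_mul (h.snd _ _) (h'.snd _ _), pd_mul (h.snd _ _) (h'.snd _ _)]
    ring

/-- The Leibniz rule for the cross product, entry by entry. -/
theorem pd_cross {A B : Plane → Mat} (hA : ∀ a b, DifferentiableAt ℝ (fun y => A y a b) x)
    (hB : ∀ a b, DifferentiableAt ℝ (fun y => B y a b) x) (a b : Fin 2) :
    DifferentiableAt ℝ (fun y => cross (A y) (B y) a b) x ∧
    pd i (fun y => cross (A y) (B y) a b) x =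
      cross (Matrix.of fun c d => pd i (fun y => A y c d) x) (B x) a b +
      cross (A x) (Matrix.of fun c d => pd i (fun y => B y c d) x) a b := by
  have e : (fun y => cross (A y) (B y) a b) = fun y => (1 / 2 : ℝ) *
      ((A y a 0 * B y 0 b + A y a 1 * B y 1 b) - (B y a 0 * A y 0 b + B y a 1 * A y 1 b)) := by
    funext y
    simp [cross, Matrix.mul_apply, Fin.sum_univ_two]
  have m (c d c' d') := (hA c d).fun_mul (hB c' d')
  have m' (c d c' d') := (hB c d).fun_mul (hA c' d')
  rw [e]
  refine ⟨(((m _ _ _ _).fun_add (m _ _ _ _)).fun_sub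
    ((m' _ _ _ _).fun_add (m' _ _ _ _))).const_mul _, ?_⟩
  rw [pd_const_mul _ (((m _ _ _ _).fun_add (m _ _ _ _)).fun_sub
    ((m' _ _ _ _).fun_add (m' _ _ _ _))), pd_sub ((m _ _ _ _).fun_add (m _ _ _ _))
    ((m' _ _ _ _).fun_add (m' _ _ _ _)), pd_add (m _ _ _ _) (m _ _ _ _),
    pd_add (m' _ _ _ _) (m' _ _ _ _), pd_mul (hA _ _) (hB _ _), pd_mul (hA _ _) (hB _ _),
    pd_mul (hB _ _) (hA _ _), pd_mul (hB _ _) (hA _ _)]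
  simp only [cross, Matrix.smul_apply, Matrix.sub_apply, Matrix.mul_apply, Fin.sum_univ_two,
    Matrix.of_apply, smul_eq_mul]
  ring

theorem pdm_conn (h : EntrySmooth W x) (h' : EntrySmooth W' x) :
    pdm i (fun y => conn (W y) (W' y)) x = conn (pdm i W x) (W' x) + conn (W x) (pdm i W' x) := by
  have c11 := pd_cross (i := i) h.fst h'.fst
  have c12 := pd_cross (i := i) h.fst h'.snd
  have c21 := pd_cross (i := i) h.snd h'.fst
  have c22 := pd_cross (i := i) h.snd h'.snd
  ext a b
  · simp only [pdm, conn, Matrix.add_apply, Matrix.sub_apply, Matrix.smul_apply, smul_eq_mul,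
      Prod.fst_add, Matrix.of_apply]
    rw [pd_add ((c11 a b).1.fun_sub ((c12 a b).1.const_mul _)) ((c21 a b).1.const_mul _),
      pd_sub (c11 a b).1 ((c12 a b).1.const_mul _), pd_const_mul _ (c12 a b).1,
      pd_const_mul _ (c21 a b).1, (c11 a b).2, (c12 a b).2, (c21 a b).2]
    ring
  · simp only [pdm, conn, Matrix.add_apply, Matrix.sub_apply, Matrix.smul_apply, smul_eq_mul,
      Prod.snd_add, Matrix.of_apply]
    rw [pd_sub ((c22 a b).1.fun_add ((c12 a b).1.const_mul _)) ((c21 a b).1.const_mul _),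
      pd_add (c22 a b).1 ((c12 a b).1.const_mul _), pd_const_mul _ (c12 a b).1,
      pd_const_mul _ (c21 a b).1, (c22 a b).2, (c12 a b).2, (c21 a b).2]
    ring

/-- Shaped for the structure equation ∂ᵢωⱼ = Γ⁰ω₀ + Γ¹ω₁ − conn(ωᵢ, ωⱼ), which `curv_frame`
differentiates once more. -/
theorem pdm_comb_sub {u v : Plane → ℝ} {V V' K : Plane → Mat × Mat}
    (hu : DifferentiableAt ℝ u x) (hv : DifferentiableAt ℝ v x)
    (hV : EntrySmooth V x) (hV' : EntrySmooth V' x)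
    (hK : EntrySmooth K x) :
    pdm i (fun y => u y • V y + v y • V' y - K y) x =
      pd i u x • V x + u x • pdm i V x + (pd i v x • V' x + v x • pdm i V' x) - pdm i K x := by
  ext a b
  · simp only [pdm, Matrix.add_apply, Matrix.sub_apply, Matrix.smul_apply, smul_eq_mul,
      Prod.fst_add, Prod.fst_sub, Prod.smul_fst, Matrix.of_apply]
    rw [pd_sub ((hu.fun_mul (hV.fst a b)).fun_add (hv.fun_mul (hV'.fst a b))) (hK.fst a b),
      pd_add (hu.fun_mul (hV.fst a b)) (hv.fun_mul (hV'.fst a b)), pd_mul hu (hV.fst a b),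
      pd_mul hv (hV'.fst a b)]
  · simp only [pdm, Matrix.add_apply, Matrix.sub_apply, Matrix.smul_apply, smul_eq_mul,
      Prod.snd_add, Prod.snd_sub, Prod.smul_snd, Matrix.of_apply]
    rw [pd_sub ((hu.fun_mul (hV.snd a b)).fun_add (hv.fun_mul (hV'.snd a b))) (hK.snd a b),
      pd_add (hu.fun_mul (hV.snd a b)) (hv.fun_mul (hV'.snd a b)), pd_mul hu (hV.snd a b),
      pd_mul hv (hV'.snd a b)]

theorem contDiffAt_cross {A B : Plane → Mat} (hA : ∀ a b, ContDiffAt ℝ ∞ (fun y => A y a b) x)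
    (hB : ∀ a b, ContDiffAt ℝ ∞ (fun y => B y a b) x) (a b : Fin 2) :
    ContDiffAt ℝ ∞ (fun y => cross (A y) (B y) a b) x := by
  have e : (fun y => cross (A y) (B y) a b) = fun y => (1 / 2 : ℝ) *
      ((A y a 0 * B y 0 b + A y a 1 * B y 1 b) - (B y a 0 * A y 0 b + B y a 1 * A y 1 b)) := by
    funext y
    simp [cross, Matrix.mul_apply, Fin.sum_univ_two]
  rw [e]
  exact contDiffAt_const.mul ((((hA _ _).mul (hB _ _)).add ((hA _ _).mul (hB _ _))).sub
    (((hB _ _).mul (hA _ _)).add ((hB _ _).mul (hA _ _))))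

theorem EntrySmooth.conn (h : EntrySmooth W x) (h' : EntrySmooth W' x) :
    EntrySmooth (fun y => conn (W y) (W' y)) x := by
  have c11 := contDiffAt_cross h.1 h'.1
  have c12 := contDiffAt_cross h.1 h'.2
  have c21 := contDiffAt_cross h.2 h'.1
  have c22 := contDiffAt_cross h.2 h'.2
  constructor <;> intro a b
  · exact ((c11 a b).sub (contDiffAt_const.mul (c12 a b))).add (contDiffAt_const.mul (c21 a b))
  · exact ((c22 a b).add (contDiffAt_const.mul (c12 a b))).sub (contDiffAt_const.mul (c21 a b))

theorem pd_inner₀ {A B : Plane → Mat} (hA : ∀ a b, ContDiffAt ℝ ∞ (fun y => A y a b) x)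
    (hB : ∀ a b, ContDiffAt ℝ ∞ (fun y => B y a b) x) :
    ContDiffAt ℝ ∞ (fun y => inner₀ (A y) (B y)) x ∧
    pd i (fun y => inner₀ (A y) (B y)) x =
      inner₀ (Matrix.of fun c d => pd i (fun y => A y c d) x) (B x) +
      inner₀ (A x) (Matrix.of fun c d => pd i (fun y => B y c d) x) := by
  have m (c d c' d') := (hA c d).mul (hB c' d')
  have dA (c d) := (hA c d).differentiableAt (by simp)
  have dB (c d) := (hB c d).differentiableAt (by simp)
  have n (c d c' d') := (dA c d).fun_mul (dB c' d')
  refine ⟨contDiffAt_const.mul ((((m _ _ _ _).sub (m _ _ _ _)).sub (m _ _ _ _)).add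
    (m _ _ _ _)), ?_⟩
  simp only [inner₀]
  rw [pd_const_mul _ ((((n _ _ _ _).fun_sub (n _ _ _ _)).fun_sub (n _ _ _ _)).fun_add
    (n _ _ _ _)), pd_add (((n _ _ _ _).fun_sub (n _ _ _ _)).fun_sub (n _ _ _ _)) (n _ _ _ _),
    pd_sub ((n _ _ _ _).fun_sub (n _ _ _ _)) (n _ _ _ _), pd_sub (n _ _ _ _) (n _ _ _ _),
    pd_mul (dA _ _) (dB _ _), pd_mul (dA _ _) (dB _ _), pd_mul (dA _ _) (dB _ _),
    pd_mul (dA _ _) (dB _ _)]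
  simp only [Matrix.of_apply]
  ring

theorem contDiffAt_g (h : EntrySmooth W x) (h' : EntrySmooth W' x) :
    ContDiffAt ℝ ∞ (fun y => g 1 (W y) (W' y)) x := by
  simp only [g_one]
  -- Only the smoothness half of `pd_inner₀` is used, so the direction 0 is arbitrary.
  exact (contDiffAt_const.mul ((pd_inner₀ (i := 0) h.1 h'.1).1.add
    (pd_inner₀ (i := 0) h.2 h'.2).1)).sub (contDiffAt_const.mul
    ((pd_inner₀ (i := 0) h.2 h'.1).1.add (pd_inner₀ (i := 0) h.1 h'.2).1))

theorem pd_g (h : EntrySmooth W x) (h' : EntrySmooth W' x) :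
    pd i (fun y => g 1 (W y) (W' y)) x = g 1 (pdm i W x) (W' x) + g 1 (W x) (pdm i W' x) := by
  obtain ⟨s11, p11⟩ := pd_inner₀ (i := i) h.1 h'.1
  obtain ⟨s12, p12⟩ := pd_inner₀ (i := i) h.1 h'.2
  obtain ⟨s21, p21⟩ := pd_inner₀ (i := i) h.2 h'.1
  obtain ⟨s22, p22⟩ := pd_inner₀ (i := i) h.2 h'.2
  replace s11 := s11.differentiableAt (by simp)
  replace s12 := s12.differentiableAt (by simp)
  replace s21 := s21.differentiableAt (by simp)
  replace s22 := s22.differentiableAt (by simp)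
  simp only [g_one]
  rw [pd_sub ((s11.fun_add s22).const_mul _) ((s21.fun_add s12).const_mul _),
    pd_const_mul _ (s11.fun_add s22), pd_const_mul _ (s21.fun_add s12), pd_add s11 s22,
    pd_add s21 s12, p11, p12, p21, p22]
  simp only [pdm]
  ring

/-! ### The left invariant frame of a parametrized surface -/

theorem left_eq_mul (q : SL × SL) (Z : Mat × Mat) : left q Z = incl q * Z := rfl

/-- Determinant one makes the inverse the adjugate, whose entries are those of the matrix up to
sign. -/
theorem entrySmooth_incl_inv {A : Plane → SL × SL} (h : EntrySmooth (fun y => incl (A y)) x) :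
    EntrySmooth (fun y => incl (A y)⁻¹) x := by
  have e (B : SL) : ((B⁻¹ : SL) : Mat) = !![B.1 1 1, -B.1 0 1; -B.1 1 0, B.1 0 0] := by
    rw [Matrix.SpecialLinearGroup.coe_inv, Matrix.adjugate_fin_two]
  constructor <;> intro a b
  · simp only [incl, Prod.fst_inv, e]
    fin_cases a <;> fin_cases b
    · exact h.1 1 1
    · exact (h.1 0 1).neg
    · exact (h.1 1 0).neg
    · exact h.1 0 0
  · simp only [incl, Prod.snd_inv, e]
    fin_cases a <;> fin_cases b
    · exact h.2 1 1
    · exact (h.2 0 1).neg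
    · exact (h.2 1 0).neg
    · exact h.2 0 0

/-- The `i`-th partial derivative of a parametrized surface in the left trivialization. -/
def frame (A : Plane → SL × SL) (i : Fin 2) (x : Plane) : Mat × Mat :=
  triv (A x) (pdm i (fun y => incl (A y)) x)

variable {A : Plane → SL × SL}

theorem incl_mul_frame (y : Plane) : incl (A y) * frame A i y = pdm i (fun y => incl (A y)) y :=
  left_triv _ _

theorem entrySmooth_frame (h : EntrySmooth (fun y => incl (A y)) x) :
    EntrySmooth (frame A i) x :=
  (entrySmooth_incl_inv h).mul h.pdm

/-- The Maurer–Cartan equation. -/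
theorem maurer_cartan (h : EntrySmooth (fun y => incl (A y)) x) :
    frame A i x * frame A j x + pdm i (frame A j) x =
      frame A j x * frame A i x + pdm j (frame A i) x := by
  -- Differentiating ∂ₗA = Aωₗ gives ∂ₖ∂ₗA = A(ωₖωₗ + ∂ₖωₗ); symmetry of the second derivatives then
  -- finishes.
  have key (k l : Fin 2) : pdm k (pdm l fun y => incl (A y)) x =
      left (A x) (frame A k x * frame A l x + pdm k (frame A l) x) := by
    have e : (pdm l fun y => incl (A y)) = fun y => incl (A y) * frame A l y :=
      funext fun y => (incl_mul_frame y).symm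
    rw [e, pdm_mul h (entrySmooth_frame h), left_eq_mul, mul_add, ← mul_assoc, incl_mul_frame]
  have := congrArg (triv (A x)) ((key i j).symm.trans ((pdm_comm h).trans (key j i)))
  simpa using this

/-- Jacobi's formula: this trace is the derivative of det B = 1. -/
theorem trace_inv_mul_pd {B : Plane → SL} (h : ∀ a b, ContDiffAt ℝ ∞ (fun y => (B y).1 a b) x) :
    ((((B x)⁻¹ : SL) : Mat) * Matrix.of fun a b => pd i (fun y => (B y).1 a b) x).trace = 0 := by
  have d (a b) : DifferentiableAt ℝ (fun y => (B y).1 a b) x := (h a b).differentiableAt (by simp)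
  have e : (fun y => (B y).1 0 0 * (B y).1 1 1 - (B y).1 0 1 * (B y).1 1 0) = fun _ => 1 := by
    funext y
    rw [← Matrix.det_fin_two]; exact (B y).2
  have e2 := congrArg (fun u => pd i u x) e
  beta_reduce at e2
  rw [pd_sub ((d _ _).fun_mul (d _ _)) ((d _ _).fun_mul (d _ _)), pd_mul (d _ _) (d _ _),
    pd_mul (d _ _) (d _ _)] at e2
  have e3 : pd i (fun _ => (1 : ℝ)) x = 0 := by simp [pd]
  rw [e3] at e2
  have tr (p q r t : ℝ) (N : Mat) : (!![t, -q; -r, p] * N).trace =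
      t * N 0 0 - q * N 1 0 - r * N 0 1 + p * N 1 1 := by
    rw [Matrix.trace_fin_two, Matrix.mul_apply, Matrix.mul_apply, Fin.sum_univ_two,
      Fin.sum_univ_two]
    simp; ring
  rw [Matrix.SpecialLinearGroup.coe_inv, Matrix.adjugate_fin_two, tr]
  change _ * pd i (fun y => (B y).1 0 0) x - _ * pd i (fun y => (B y).1 1 0) x -
    _ * pd i (fun y => (B y).1 0 1) x + _ * pd i (fun y => (B y).1 1 1) x = 0
  linarith

theorem trace_frame_fst (h : EntrySmooth (fun y => incl (A y)) x) : (frame A i x).1.trace = 0 :=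
  trace_inv_mul_pd (B := fun y => (A y).1) h.1

theorem trace_frame_snd (h : EntrySmooth (fun y => incl (A y)) x) : (frame A i x).2.trace = 0 :=
  trace_inv_mul_pd (B := fun y => (A y).2) h.2

/-! ### Christoffel symbols and the Gauss equation -/

/-- The Gram matrix of the frame. -/
def metric (A : Plane → SL × SL) (x : Plane) : Matrix (Fin 2) (Fin 2) ℝ :=
  Matrix.of fun i j => g 1 (frame A i x) (frame A j x)

theorem metric_comm (y : Plane) : metric A y i j = metric A y j i := g_comm _ _

theorem contDiffAt_metric (h : EntrySmooth (fun y => incl (A y)) x) :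
    ContDiffAt ℝ ∞ (fun y => metric A y i j) x :=
  contDiffAt_g (entrySmooth_frame h) (entrySmooth_frame h)

/-- Pairing with both frame vectors and applying Cramer's rule to the Gram matrix. -/
theorem coeff_eq_of_det_ne_zero (h : (metric A x).det ≠ 0) {a b c d : ℝ}
    (e : a • frame A 0 x + b • frame A 1 x = c • frame A 0 x + d • frame A 1 x) :
    a = c ∧ b = d := by
  have e0 := congrArg (g 1 (frame A 0 x)) e
  have e1 := congrArg (g 1 (frame A 1 x)) e
  simp only [g_add_right, g_smul_right] at e0 e1
  rw [Matrix.det_fin_two] at h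
  simp only [metric, Matrix.of_apply] at h
  constructor
  · refine mul_right_cancel₀ h ?_
    linear_combination g 1 (frame A 1 x) (frame A 1 x) * e0 - g 1 (frame A 0 x) (frame A 1 x) * e1
  · refine mul_right_cancel₀ h ?_
    linear_combination g 1 (frame A 0 x) (frame A 0 x) * e1 - g 1 (frame A 1 x) (frame A 0 x) * e0

/-- Metric compatibility: by `conn_metric`, adding the connection term to both derivatives in the
Leibniz rule changes nothing. -/
theorem pd_metric (h : EntrySmooth (fun y => incl (A y)) x) {c : Fin 2 → Fin 2 → Fin 2 → ℝ}
    (hc : ∀ i j, pdm i (frame A j) x + conn (frame A i x) (frame A j x) =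
      c 0 i j • frame A 0 x + c 1 i j • frame A 1 x) (i j l : Fin 2) :
    pd i (fun y => metric A y j l) x = c 0 i j * metric A x 0 l + c 1 i j * metric A x 1 l +
      (c 0 i l * metric A x 0 j + c 1 i l * metric A x 1 j) := by
  have e := pd_g (i := i) (entrySmooth_frame h (i := j)) (entrySmooth_frame h (i := l))
  have m := conn_metric (frame A i x) (frame A j x) (frame A l x)
  have e1 := congrArg (fun Z => g 1 Z (frame A l x)) (hc i j)
  have e2 := congrArg (fun Z => g 1 (frame A j x) Z) (hc i l)
  simp only [g_add_left, g_add_right, g_smul_left, g_smul_right] at e1 e2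
  have n0 := g_comm (frame A 0 x) (frame A j x)
  have n1 := g_comm (frame A 1 x) (frame A j x)
  simp only [metric, Matrix.of_apply]
  rw [e]
  linear_combination e1 + e2 - m - c 0 i l * n0 - c 1 i l * n1

/-- Torsion-freeness in coordinates: the bracket in the Maurer–Cartan equation cancels the one in
`conn_torsion`. -/
theorem connection_symm (h : EntrySmooth (fun y => incl (A y)) x) (hd : (metric A x).det ≠ 0)
    {c : Fin 2 → Fin 2 → Fin 2 → ℝ}
    (hc : ∀ i j, pdm i (frame A j) x + conn (frame A i x) (frame A j x) =
      c 0 i j • frame A 0 x + c 1 i j • frame A 1 x) (k i j : Fin 2) : c k i j = c k j i := by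
  have m := maurer_cartan (i := i) (j := j) h
  have t : conn (frame A i x) (frame A j x) - conn (frame A j x) (frame A i x) =
    frame A i x * frame A j x - frame A j x * frame A i x := conn_torsion _ _
  have e := coeff_eq_of_det_ne_zero hd (a := c 0 i j) (b := c 1 i j) (c := c 0 j i)
    (d := c 1 j i) (by
      rw [← hc, ← hc, ← sub_eq_zero]
      rw [← sub_eq_zero] at m t
      linear_combination (norm := module) m + t)
  fin_cases k
  exacts [e.1, e.2]

/-- The connection coefficients of a totally geodesic surface are the Christoffel symbols of the
induced metric. -/
theorem christoffel_eq (h : EntrySmooth (fun y => incl (A y)) x) (hd : (metric A x).det ≠ 0)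
    {c : Fin 2 → Fin 2 → Fin 2 → ℝ}
    (hc : ∀ i j, pdm i (frame A j) x + conn (frame A i x) (frame A j x) =
      c 0 i j • frame A 0 x + c 1 i j • frame A 1 x) (k i j : Fin 2) :
    christoffel (metric A) k i j x = c k i j := by
  have hs := connection_symm h hd hc
  have hu : IsUnit (metric A x).det := isUnit_iff_ne_zero.2 hd
  have hi := Matrix.nonsing_inv_mul _ hu
  -- The Koszul computation: compatibility and symmetry determine the coefficients once the metric
  -- is inverted.
  have key (l : Fin 2) : pd i (fun y => metric A y j l) x + pd j (fun y => metric A y i l) x -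
      pd l (fun y => metric A y i j) x =
        2 * (metric A x l 0 * c 0 i j + metric A x l 1 * c 1 i j) := by
    rw [pd_metric h hc, pd_metric h hc, pd_metric h hc, hs 0 j i, hs 1 j i, hs 0 l i, hs 1 l i,
      hs 0 l j, hs 1 l j, metric_comm (i := l) (j := 0), metric_comm (i := l) (j := 1)]
    ring
  have h0 := congrFun (congrFun hi k) 0
  have h1 := congrFun (congrFun hi k) 1
  rw [Matrix.mul_apply, Fin.sum_univ_two] at h0 h1
  simp only [christoffel, key, Fin.sum_univ_two]
  have : (1 : Matrix (Fin 2) (Fin 2) ℝ) k 0 * c 0 i j + (1 : Matrix (Fin 2) (Fin 2) ℝ) k 1 * c 1 i j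
      = c k i j := by
    rcases Fin.exists_fin_two.1 ⟨k, rfl⟩ with rfl | rfl <;> simp
  rw [← this]
  linear_combination c 0 i j * h0 + c 1 i j * h1

theorem contDiffAt_christoffel (h : EntrySmooth (fun y => incl (A y)) x)
    (hd : (metric A x).det ≠ 0) (k i j : Fin 2) :
    ContDiffAt ℝ ∞ (christoffel (metric A) k i j) x := by
  have hG (i j) : ContDiffAt ℝ ∞ (fun y => metric A y i j) x := contDiffAt_metric h
  have hdet : ContDiffAt ℝ ∞ (fun y => (metric A y).det) x := by
    simp only [Matrix.det_fin_two]
    exact ((hG _ _).mul (hG _ _)).sub ((hG _ _).mul (hG _ _))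
  have hinv (l : Fin 2) : ContDiffAt ℝ ∞ (fun y => (metric A y)⁻¹ k l) x := by
    simp only [Matrix.inv_def, Ring.inverse_eq_inv', Matrix.adjugate_fin_two, Matrix.smul_apply,
      smul_eq_mul]
    refine (hdet.inv hd).mul ?_
    fin_cases k <;> fin_cases l
    · exact hG 1 1
    · exact (hG 0 1).neg
    · exact (hG 1 0).neg
    · exact hG 0 0
  have hterm (l : Fin 2) := (hinv l).mul (((contDiffAt_pd (i := i) (hG j l)).add
    (contDiffAt_pd (i := j) (hG i l))).sub (contDiffAt_pd (i := l) (hG i j)))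
  unfold christoffel
  simp only [Fin.sum_univ_two]
  exact contDiffAt_const.mul ((hterm 0).add (hterm 1))

/-- The Gauss equation of a totally geodesic surface. -/
theorem curv_frame {U : Set Plane} (hU : IsOpen U)
    (h : ∀ y ∈ U, EntrySmooth (fun y => incl (A y)) y) (hd : ∀ y ∈ U, (metric A y).det ≠ 0)
    (hg : ∀ y ∈ U, ∀ i j, pdm i (frame A j) y + conn (frame A i y) (frame A j y) ∈
      Submodule.span ℝ {frame A 0 y, frame A 1 y}) (hx : x ∈ U) (k : Fin 2) :
    curv (frame A 0 x) (frame A 1 x) (frame A k x) =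
      riemann (metric A) 0 0 1 k x • frame A 0 x + riemann (metric A) 1 0 1 k x • frame A 1 x := by
  -- The structure equation is needed on all of `U`, because it is differentiated below.
  have hΓ (y) (hy : y ∈ U) (i j) : pdm i (frame A j) y =
      christoffel (metric A) 0 i j y • frame A 0 y + christoffel (metric A) 1 i j y • frame A 1 y -
      conn (frame A i y) (frame A j y) := by
    have hex (i j) := Submodule.mem_span_pair.1 (hg y hy i j)
    choose a b hab using hex
    have hc (k) := christoffel_eq (h y hy) (hd y hy) (c := fun k i j => ![a i j, b i j] k)
      (fun i j => (hab i j).symm) k i j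
    rw [hc, hc]
    exact eq_sub_of_add_eq (hab i j).symm
  have hω (l) : EntrySmooth (frame A l) x := entrySmooth_frame (h x hx)
  have hdiff (l i j) : DifferentiableAt ℝ (christoffel (metric A) l i j) x :=
    (contDiffAt_christoffel (h x hx) (hd x hx) l i j).differentiableAt (by simp)
  have h2 (i j) : pdm i (pdm j (frame A k)) x = _ :=
    (pdm_congr (Filter.eventuallyEq_of_mem (hU.mem_nhds hx) fun y hy => hΓ y hy j k)).trans
      (pdm_comb_sub (hdiff 0 j k) (hdiff 1 j k) (hω 0) (hω 1) ((hω j).conn (hω k)))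
  have hs := pdm_comm (i := 0) (j := 1) (hω k)
  rw [h2, h2, pdm_conn (hω _) (hω _), pdm_conn (hω _) (hω _)] at hs
  have m := maurer_cartan (i := 0) (j := 1) (h x hx)
  -- Maurer–Cartan replaces one mixed derivative by the other and produces the bracket term of
  -- `curv`.
  have m' : pdm 0 (frame A 1) x = pdm 1 (frame A 0) x -
      (frame A 0 x * frame A 1 x - frame A 1 x * frame A 0 x) := by
    rw [← sub_eq_zero] at m ⊢
    rw [← m]; abel
  have q := congrArg (fun Z => conn Z (frame A k x)) m'
  simp only [conn_sub_left _ _ (frame A k x)] at q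
  rw [q] at hs
  -- This term now occurs on both sides and cancels; making it opaque keeps `hΓ` from expanding it.
  generalize conn (pdm 1 (frame A 0) x) (frame A k x) = Q at hs
  simp only [hΓ x hx, conn_add_right, conn_sub_right, conn_smul_right] at hs
  simp only [curv, riemann, Fin.sum_univ_two, conn_sub_left]
  linear_combination (norm := module) (-1 : ℝ) • hs

end Calculus

/-! ### Coordinate vector fields -/

section Manifold

variable {M : Type*} [TopologicalSpace M] [ChartedSpace (EuclideanSpace ℝ (Fin 2)) M]

/-- The map `F` in the chart around `p`. -/
def inChart (F : M → SL × SL) (p : M) (x : Plane) : SL × SL := F ((extChartAt (𝓡 2) p).symm x)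

theorem g_eq_g_one (q : SL × SL) (Z W : Mat × Mat) : g q Z W = g 1 (triv q Z) (triv q W) := by
  rw [← g_left q, left_triv, left_triv]

theorem P_P (q : SL × SL) (Z : Mat × Mat) : P q (P q Z) = Z := by
  simp [P]

theorem P_image_eq (q : SL × SL) {S : Set (Mat × Mat)} (h : ∀ Z ∈ S, P q Z ∈ S) :
    P q '' S = S := by
  apply Set.Subset.antisymm
  · rintro _ ⟨Z, hZ, rfl⟩
    exact h Z hZ
  · intro Z hZ
    exact ⟨P q Z, h Z hZ, P_P q Z⟩

variable {F : M → SL × SL} {p q : M} {i j : Fin 2}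

theorem inducedMetric_eq : inducedMetric F p = metric (inChart F p) := by
  funext x
  ext i j
  simp only [inducedMetric, metric, Matrix.of_apply, g_eq_g_one (F _)]
  rfl

/-- P is self-adjoint for g, so it preserves the orthogonal complement of an invariant subspace. -/
theorem P_image_normalSpace (h : P (F q) '' tangentPlane F q = tangentPlane F q) :
    P (F q) '' normalSpace F q = normalSpace F q := by
  refine P_image_eq _ fun Z hZ => ⟨?_, fun W hW => ?_⟩
  · obtain ⟨⟨h₁, h₂⟩, -⟩ := hZ
    change (triv (F q) (P (F q) Z)).1.trace = 0 ∧ (triv (F q) (P (F q) Z)).2.trace = 0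
    rw [P, triv_left]
    exact ⟨h₂, h₁⟩
  · have hPW : P (F q) W ∈ tangentPlane F q := h ▸ ⟨W, hW, rfl⟩
    have := hZ.2 _ hPW
    rw [g_eq_g_one, P, triv_left] at this ⊢
    rw [← this]
    exact (g_swap_left (triv (F q) W) (triv (F q) Z)).symm

theorem dF_comb (a b : ℝ) (v w : TangentSpace (𝓡 2) q) :
    dF F q (a • v + b • w) = a • dF F q v + b • dF F q w := by
  ext i j
  · have h := (mfderiv (𝓡 2) 𝓘(ℝ, ℝ) (fun q => (incl (F q)).1 i j) q).map_add (a • v) (b • w)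
    rw [map_smul, map_smul] at h
    exact h
  · have h := (mfderiv (𝓡 2) 𝓘(ℝ, ℝ) (fun q => (incl (F q)).2 i j) q).map_add (a • v) (b • w)
    rw [map_smul, map_smul] at h
    exact h

variable [IsManifold (𝓡 2) ∞ M]

/-- The coordinate vector field `∂_i` of the chart around `p`. -/
def coordField (p : M) (i : Fin 2) (q : M) : TangentSpace (𝓡 2) q :=
  (trivializationAt Plane (TangentSpace (𝓡 2)) p).symmL ℝ q (EuclideanSpace.single i 1)

theorem contMDiffAt_coordField (hq : q ∈ (extChartAt (𝓡 2) p).source) :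
    ContMDiffAt (𝓡 2) (𝓡 2).tangent ∞
      (fun q => (⟨q, coordField p i q⟩ : TangentBundle (𝓡 2) M)) q := by
  set e := trivializationAt Plane (TangentSpace (𝓡 2) : M → Type) p
  have hb : q ∈ e.baseSet := by simpa [e] using hq
  refine ContMDiffOn.contMDiffAt ?_ (e.open_baseSet.mem_nhds hb)
  rw [e.contMDiffOn_section_baseSet_iff]
  apply (contMDiffOn_const (c := EuclideanSpace.single i 1)).congr
  intro y hy
  simp only [coordField]
  rw [e.symmL_apply, e.apply_mk_symm hy]
  exact hy

/-- The coordinate field is the derivative of the inverse chart on a basis vector, so this is the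
chain rule. -/
theorem mfderiv_coordField {u : M → ℝ} (hq : q ∈ (extChartAt (𝓡 2) p).source)
    (hu : MDifferentiableAt (𝓡 2) 𝓘(ℝ, ℝ) u q) :
    mfderiv (𝓡 2) 𝓘(ℝ, ℝ) u q (coordField p i q) =
      pd i (fun y => u ((extChartAt (𝓡 2) p).symm y)) (extChartAt (𝓡 2) p q) := by
  have hq' : q ∈ (chartAt Plane p).source := by simpa using hq
  have hl := (extChartAt (𝓡 2) p).left_inv hq
  have hs := mdifferentiableWithinAt_extChartAt_symm (I := 𝓡 2)
    ((extChartAt (𝓡 2) p).map_source hq)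
  rw [coordField, TangentBundle.symmL_trivializationAt hq']
  simp only [ModelWithCorners.range_eq_univ, mfderivWithin_univ, mdifferentiableWithinAt_univ]
    at hs ⊢
  have hu' : MDifferentiableAt (𝓡 2) 𝓘(ℝ, ℝ) u
      ((extChartAt (𝓡 2) p).symm (extChartAt (𝓡 2) p q)) := by rwa [hl]
  have := mfderiv_comp (extChartAt (𝓡 2) p q) hu' hs
  rw [mfderiv_eq_fderiv] at this
  have h2 := congrArg (fun L => L (EuclideanSpace.single i 1)) this
  refine Eq.trans ?_ h2.symm
  -- Viewing both derivatives on the fixed model plane removes the dependence of their types on the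
  -- base point, so `hl` can be rewritten.
  change (mfderiv (𝓡 2) 𝓘(ℝ, ℝ) u q : Plane →L[ℝ] ℝ) _ =
    (mfderiv (𝓡 2) 𝓘(ℝ, ℝ) u ((extChartAt (𝓡 2) p).symm (extChartAt (𝓡 2) p q)) :
      Plane →L[ℝ] ℝ) _
  rw [hl]
  rfl

theorem exists_coordField (hq : q ∈ (extChartAt (𝓡 2) p).source) (v : TangentSpace (𝓡 2) q) :
    ∃ a b : ℝ, v = a • coordField p 0 q + b • coordField p 1 q := by
  set e := trivializationAt Plane (TangentSpace (𝓡 2) : M → Type) p with he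
  have hb : q ∈ e.baseSet := by simpa [e] using hq
  set w : Plane := e.continuousLinearMapAt ℝ q v with hw
  have hv : e.symmL ℝ q w = v := e.symmL_continuousLinearMapAt hb v
  have e1 : w = w 0 • EuclideanSpace.single 0 1 + w 1 • EuclideanSpace.single 1 1 := by
    ext k; fin_cases k <;> simp
  refine ⟨w 0, w 1, ?_⟩
  rw [e1, map_add, map_smul, map_smul] at hv
  exact hv.symm

theorem coordField_ne_zero (hq : q ∈ (extChartAt (𝓡 2) p).source) : coordField p i q ≠ 0 := by
  set e := trivializationAt Plane (TangentSpace (𝓡 2) : M → Type) p with he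
  have hb : q ∈ e.baseSet := by simpa [e] using hq
  intro h
  have h1 := congrArg (e.continuousLinearMapAt ℝ q) h
  rw [coordField, map_zero] at h1
  have h2 := e.continuousLinearMapAt_symmL (R := ℝ) hb (EuclideanSpace.single i 1)
  have h3 := h2.symm.trans h1
  simp at h3

theorem matDeriv_coordField {W : M → Mat × Mat} (hq : q ∈ (extChartAt (𝓡 2) p).source)
    (h₁ : ∀ a b, MDifferentiableAt (𝓡 2) 𝓘(ℝ, ℝ) (fun r => (W r).1 a b) q)
    (h₂ : ∀ a b, MDifferentiableAt (𝓡 2) 𝓘(ℝ, ℝ) (fun r => (W r).2 a b) q) :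
    matDeriv W q (coordField p i q) =
      pdm i (fun y => W ((extChartAt (𝓡 2) p).symm y)) (extChartAt (𝓡 2) p q) := by
  ext a b
  · exact mfderiv_coordField hq (h₁ a b)
  · exact mfderiv_coordField hq (h₂ a b)

/-! ### Almost complex surfaces in a chart -/

theorem entrySmooth_inChart (hF : IsAlmostComplexSurface F) {x : Plane}
    (hx : x ∈ (extChartAt (𝓡 2) p).target) :
    EntrySmooth (fun y => incl (inChart F p y)) x := by
  have key {u : M → ℝ} (hu : ContMDiff (𝓡 2) 𝓘(ℝ, ℝ) ∞ u) :
      ContDiffAt ℝ ∞ (fun y => u ((extChartAt (𝓡 2) p).symm y)) x := by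
    have h := hu.comp_contMDiffOn (contMDiffOn_extChartAt_symm (I := 𝓡 2) (n := ∞) p)
    exact (contMDiffOn_iff_contDiffOn.1 h).contDiffAt ((isOpen_extChartAt_target p).mem_nhds hx)
  exact ⟨fun a b => key (hF.smooth₁ a b), fun a b => key (hF.smooth₂ a b)⟩

theorem dF_coordField (hF : IsAlmostComplexSurface F) (hq : q ∈ (extChartAt (𝓡 2) p).source) :
    dF F q (coordField p i q) = left (F q) (frame (inChart F p) i (extChartAt (𝓡 2) p q)) := by
  have h := matDeriv_coordField (i := i) (W := fun r => incl (F r)) hq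
    (fun a b => ((hF.smooth₁ a b).mdifferentiable (by simp)) q)
    (fun a b => ((hF.smooth₂ a b).mdifferentiable (by simp)) q)
  rw [dF, h, frame, inChart, (extChartAt (𝓡 2) p).left_inv hq, left_triv]
  rfl

theorem mem_tangentPlane_iff (hF : IsAlmostComplexSurface F)
    (hq : q ∈ (extChartAt (𝓡 2) p).source) {Z : Mat × Mat} :
    Z ∈ tangentPlane F q ↔ triv (F q) Z ∈ Submodule.span ℝ
      {frame (inChart F p) 0 (extChartAt (𝓡 2) p q),
        frame (inChart F p) 1 (extChartAt (𝓡 2) p q)} := by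
  rw [Submodule.mem_span_pair]
  constructor
  · rintro ⟨v, rfl⟩
    obtain ⟨a, b, rfl⟩ := exists_coordField hq v
    refine ⟨a, b, ?_⟩
    rw [dF_comb, dF_coordField hF hq, dF_coordField hF hq, map_add, map_smul, map_smul, triv_left,
      triv_left]
  · rintro ⟨a, b, h⟩
    refine ⟨a • coordField p 0 q + b • coordField p 1 q, ?_⟩
    rw [dF_comb, dF_coordField hF hq, dF_coordField hF hq, ← map_smul, ← map_smul, ← map_add, h,
      left_triv]

theorem frame_ne_zero (hF : IsAlmostComplexSurface F) (hq : q ∈ (extChartAt (𝓡 2) p).source) :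
    frame (inChart F p) i (extChartAt (𝓡 2) p q) ≠ 0 := by
  intro h
  have h1 := dF_coordField (i := i) hF hq
  rw [h, map_zero] at h1
  have h0 : dF F q 0 = 0 := by
    have := dF_comb (F := F) 0 0 (0 : TangentSpace (𝓡 2) q) 0
    simpa using this
  exact coordField_ne_zero hq (hF.immersion q (h1.trans h0.symm))

theorem exists_frame_eq (hF : IsAlmostComplexSurface F) (hq : q ∈ (extChartAt (𝓡 2) p).source) :
    ∃ a b : ℝ, b ≠ 0 ∧ frame (inChart F p) 1 (extChartAt (𝓡 2) p q) =
      a • frame (inChart F p) 0 (extChartAt (𝓡 2) p q) +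
      b • J₁ (frame (inChart F p) 0 (extChartAt (𝓡 2) p q)) := by
  refine exists_eq_of_J₁_mem_span (frame_ne_zero hF hq) ?_
  have h : J (F q) (left (F q) (frame (inChart F p) 0 (extChartAt (𝓡 2) p q))) ∈
      tangentPlane F q := by
    rw [← hF.almostComplex q, ← dF_coordField hF hq]
    exact ⟨_, ⟨_, rfl⟩, rfl⟩
  rwa [mem_tangentPlane_iff hF hq, J_left, triv_left] at h

theorem mem_tangentPlane_iff_complexLine (hF : IsAlmostComplexSurface F)
    (hq : q ∈ (extChartAt (𝓡 2) p).source) {Z : Mat × Mat} :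
    Z ∈ tangentPlane F q ↔ triv (F q) Z ∈
      complexLine (frame (inChart F p) 0 (extChartAt (𝓡 2) p q)) := by
  obtain ⟨a, b, hb, h⟩ := exists_frame_eq hF hq
  rw [mem_tangentPlane_iff hF hq, span_pair_eq_complexLine hb h]

/-- Since g(ξ, Jξ) = 0, a null ξ would be orthogonal to its whole complex line, contradicting
nondegeneracy. -/
theorem g_frame_ne_zero (hF : IsAlmostComplexSurface F) (hq : q ∈ (extChartAt (𝓡 2) p).source) :
    g 1 (frame (inChart F p) 0 (extChartAt (𝓡 2) p q))
      (frame (inChart F p) 0 (extChartAt (𝓡 2) p q)) ≠ 0 := by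
  intro h
  refine coordField_ne_zero hq (hF.nondegenerate q (coordField p 0 q) fun w => ?_)
  obtain ⟨a, b, hw⟩ := mem_complexLine.1 ((mem_tangentPlane_iff_complexLine hF hq).1 ⟨w, rfl⟩)
  rw [g_eq_g_one, dF_coordField hF hq, triv_left, ← hw, g_add_right, g_smul_right, g_smul_right, h,
    g_comm _ (J₁ _), g_J₁_self]
  ring

theorem det_metric (hF : IsAlmostComplexSurface F) (hq : q ∈ (extChartAt (𝓡 2) p).source) :
    (metric (inChart F p) (extChartAt (𝓡 2) p q)).det ≠ 0 := by
  obtain ⟨a, b, hb, h⟩ := exists_frame_eq hF hq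
  rw [Matrix.det_fin_two]
  simp only [metric, Matrix.of_apply]
  rw [gram_eq h]
  exact mul_ne_zero (pow_ne_zero _ hb) (pow_ne_zero _ (g_frame_ne_zero hF hq))

/-- The totally geodesic condition tested on coordinate fields. They agree with the frame only over
the chart domain, which is enough for derivatives. -/
theorem connection_mem (hF : IsAlmostComplexSurface F) (hgeo : IsTotallyGeodesic F)
    (hq : q ∈ (extChartAt (𝓡 2) p).source) (i j : Fin 2) :
    pdm i (frame (inChart F p) j) (extChartAt (𝓡 2) p q) +
      conn (frame (inChart F p) i (extChartAt (𝓡 2) p q))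
        (frame (inChart F p) j (extChartAt (𝓡 2) p q)) ∈
    Submodule.span ℝ {frame (inChart F p) 0 (extChartAt (𝓡 2) p q),
        frame (inChart F p) 1 (extChartAt (𝓡 2) p q)} := by
  have h := hgeo q (coordField p j) (contMDiffAt_coordField hq) (coordField p i q)
  rw [mem_tangentPlane_iff hF hq, covDeriv, triv_left, dF_coordField hF hq, dF_coordField hF hq,
    triv_left, triv_left] at h
  have hW (r) (hr : r ∈ (extChartAt (𝓡 2) p).source) :
      triv (F r) (dF F r (coordField p j r)) = frame (inChart F p) j (extChartAt (𝓡 2) p r) := by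
    rw [dF_coordField hF hr, triv_left]
  have hs := entrySmooth_frame (i := j)
    (entrySmooth_inChart hF ((extChartAt (𝓡 2) p).map_source hq))
  have hφ := mdifferentiableAt_extChartAt (I := 𝓡 2) (x := p) (y := q) (by simpa using hq)
  have hev := (isOpen_extChartAt_source (I := 𝓡 2) p).mem_nhds hq
  have e := matDeriv_coordField (i := i)
    (W := fun r => triv (F r) (dF F r (coordField p j r))) hq
    (fun a b => ((hs.fst a b).mdifferentiableAt.comp q hφ).congr_of_eventuallyEq
      (Filter.eventuallyEq_of_mem hev fun r hr => by simp only [hW r hr]; rfl))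
    (fun a b => ((hs.snd a b).mdifferentiableAt.comp q hφ).congr_of_eventuallyEq
      (Filter.eventuallyEq_of_mem hev fun r hr => by simp only [hW r hr]; rfl))
  rw [e] at h
  have e2 := pdm_congr (i := i)
    (W := fun y => triv (F ((extChartAt (𝓡 2) p).symm y)) (dF F ((extChartAt (𝓡 2) p).symm y)
      (coordField p j ((extChartAt (𝓡 2) p).symm y)))) (W' := frame (inChart F p) j)
    (Filter.eventuallyEq_of_mem ((isOpen_extChartAt_target (I := 𝓡 2) p).mem_nhds
      ((extChartAt (𝓡 2) p).map_source hq)) fun y hy => by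
        rw [hW _ ((extChartAt (𝓡 2) p).map_target hy), (extChartAt (𝓡 2) p).right_inv hy])
  rwa [e2] at h

theorem gauss_equation (hF : IsAlmostComplexSurface F) (hgeo : IsTotallyGeodesic F)
    (hq : q ∈ (extChartAt (𝓡 2) p).source) (k : Fin 2) :
    curv (frame (inChart F p) 0 (extChartAt (𝓡 2) p q))
      (frame (inChart F p) 1 (extChartAt (𝓡 2) p q))
      (frame (inChart F p) k (extChartAt (𝓡 2) p q)) =
    riemann (metric (inChart F p)) 0 0 1 k (extChartAt (𝓡 2) p q) •
      frame (inChart F p) 0 (extChartAt (𝓡 2) p q) +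
    riemann (metric (inChart F p)) 1 0 1 k (extChartAt (𝓡 2) p q) •
      frame (inChart F p) 1 (extChartAt (𝓡 2) p q) := by
  have key (y) (hy : y ∈ (extChartAt (𝓡 2) p).target) := (extChartAt (𝓡 2) p).right_inv hy
  have key' (y) (hy : y ∈ (extChartAt (𝓡 2) p).target) := (extChartAt (𝓡 2) p).map_target hy
  refine curv_frame (isOpen_extChartAt_target (I := 𝓡 2) p) (fun y hy => entrySmooth_inChart hF hy)
    (fun y hy => ?_) (fun y hy i j => ?_) ((extChartAt (𝓡 2) p).map_source hq) k
  · rw [← key y hy]; exact det_metric hF (key' y hy)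
  · rw [← key y hy]; exact connection_mem hF hgeo (key' y hy) i j

/-- By the Gauss equation the ambient curvature preserves the tangent line, so the algebraic
alternative applies. -/
theorem angle_dichotomy (hF : IsAlmostComplexSurface F) (hgeo : IsTotallyGeodesic F)
    (hq : q ∈ (extChartAt (𝓡 2) p).source) :
    angle (frame (inChart F p) 0 (extChartAt (𝓡 2) p q)) = 0 ∨
    (frame (inChart F p) 0 (extChartAt (𝓡 2) p q)).swap ∈
      complexLine (frame (inChart F p) 0 (extChartAt (𝓡 2) p q)) := by
  have hs := entrySmooth_inChart hF ((extChartAt (𝓡 2) p).map_source hq)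
  obtain ⟨a, b, hb, h⟩ := exists_frame_eq hF hq
  have hc (k) := Submodule.mem_span_pair.2 ⟨_, _, (gauss_equation hF hgeo hq k).symm⟩
  rw [span_pair_eq_complexLine hb h] at hc
  exact angle_eq_zero_or_swap_mem (trace_frame_fst hs) (trace_frame_snd hs)
    (curv_mem_complexLine hb h (hc 0) (hc 1))

theorem gaussianCurvature_eq (hF : IsAlmostComplexSurface F) (hgeo : IsTotallyGeodesic F) :
    gaussianCurvature F p = 4 / 3 * (angle (frame (inChart F p) 0 (extChartAt (𝓡 2) p p)) /
      g 1 (frame (inChart F p) 0 (extChartAt (𝓡 2) p p))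
        (frame (inChart F p) 0 (extChartAt (𝓡 2) p p)) ^ 2 - 1) := by
  have hp := mem_extChartAt_source (I := 𝓡 2) p
  have hs := entrySmooth_inChart hF ((extChartAt (𝓡 2) p).map_source hp)
  obtain ⟨a, b, hb, h⟩ := exists_frame_eq hF hp
  have hc := congrArg (fun Z => g 1 Z (frame (inChart F p) 0 (extChartAt (𝓡 2) p p)))
    (gauss_equation hF hgeo hp 1)
  simp only [g_add_left, g_smul_left] at hc
  rw [curv_eq_angle (trace_frame_fst hs) (trace_frame_snd hs) h] at hc
  rw [gaussianCurvature, coordCurvature, inducedMetric_eq, Fin.sum_univ_two, Matrix.det_fin_two]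
  simp only [metric, Matrix.of_apply] at hc ⊢
  rw [gram_eq h]
  have hg := g_frame_ne_zero hF hp
  refine (congrArg (· / _) hc.symm).trans ?_
  field_simp

/-! ### The two types of totally geodesic surfaces -/

/-- Turns a chart-free condition on planes into the vanishing of a function that is continuous in
the chart, as `isClopen_normal_type` requires. -/
theorem P_image_subset_normalSpace_iff (hF : IsAlmostComplexSurface F)
    (hq : q ∈ (extChartAt (𝓡 2) p).source) :
    P (F q) '' tangentPlane F q ⊆ normalSpace F q ↔
      angle (frame (inChart F p) 0 (extChartAt (𝓡 2) p q)) = 0 := by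
  set ξ := frame (inChart F p) 0 (extChartAt (𝓡 2) p q) with hξ
  have hs := entrySmooth_inChart hF ((extChartAt (𝓡 2) p).map_source hq)
  have mem {Z} := mem_tangentPlane_iff_complexLine (Z := Z) hF hq
  have mem' {Z} (hZ : Z ∈ complexLine ξ) : left (F q) Z ∈ tangentPlane F q := by
    rwa [mem, triv_left]
  have h₀ : ξ ∈ complexLine ξ := mem_complexLine.2 ⟨1, 0, by module⟩
  constructor
  · intro h
    obtain ⟨-, h⟩ := h ⟨_, mem' h₀, rfl⟩
    have h₁ := h _ (mem' h₀)
    have h₂ := h _ (mem' (J₁_mem_complexLine h₀))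
    rw [P_left, g_left, g_comm] at h₁ h₂
    exact angle_eq_zero_iff.2 ⟨h₁, h₂⟩
  · rintro h _ ⟨Z, hZ, rfl⟩
    have hZ' := mem.1 hZ
    refine ⟨?_, fun W hW => ?_⟩
    · have hT : triv (F q) Z ∈ complexLine ξ := hZ'
      obtain ⟨a, b, e⟩ := mem_complexLine.1 hT
      have t₁ : ξ.1.trace = 0 := trace_frame_fst hs
      have t₂ : ξ.2.trace = 0 := trace_frame_snd hs
      change (triv (F q) (P (F q) Z)).1.trace = 0 ∧ (triv (F q) (P (F q) Z)).2.trace = 0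
      rw [P, triv_left, ← e]
      simp [J₁, t₁, t₂]
    · rw [g_eq_g_one, P, triv_left, g_comm]
      exact g_swap_eq_zero h hZ' (mem.1 hW)

theorem P_image_tangentPlane (hF : IsAlmostComplexSurface F)
    (hq : q ∈ (extChartAt (𝓡 2) p).source)
    (h : (frame (inChart F p) 0 (extChartAt (𝓡 2) p q)).swap ∈
      complexLine (frame (inChart F p) 0 (extChartAt (𝓡 2) p q))) :
    P (F q) '' tangentPlane F q = tangentPlane F q := by
  refine P_image_eq _ fun Z hZ => ?_
  rw [mem_tangentPlane_iff_complexLine hF hq] at hZ ⊢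
  rw [P, triv_left]
  exact swap_mem_complexLine h hZ

theorem isClopen_normal_type (hF : IsAlmostComplexSurface F) (hgeo : IsTotallyGeodesic F) :
    IsClopen {q : M | P (F q) '' tangentPlane F q ⊆ normalSpace F q} := by
  have hcont (p : M) : ContinuousAt (fun q : M =>
      angle (frame (inChart F p) 0 (extChartAt (𝓡 2) p q))) p ∧ ContinuousAt (fun q : M =>
      g 1 (frame (inChart F p) 0 (extChartAt (𝓡 2) p q))
      (frame (inChart F p) 0 (extChartAt (𝓡 2) p q)) ^ 2) p := by
    have hs := entrySmooth_frame (i := 0)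
      (entrySmooth_inChart hF (mem_extChartAt_target (I := 𝓡 2) p))
    have hsw : EntrySmooth (fun y => (frame (inChart F p) 0 y).swap) (extChartAt (𝓡 2) p p) :=
      ⟨hs.2, hs.1⟩
    have hJ : EntrySmooth (fun y => J₁ (frame (inChart F p) 0 y)) (extChartAt (𝓡 2) p p) := by
      constructor <;> intro a b
      · exact contDiffAt_const.mul ((hs.1 a b).sub (contDiffAt_const.mul (hs.2 a b)))
      · exact contDiffAt_const.mul ((contDiffAt_const.mul (hs.1 a b)).sub (hs.2 a b))
    have c₁ := (contDiffAt_g hsw hs).continuousAt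
    have c₂ := (contDiffAt_g hsw hJ).continuousAt
    have c₃ := (contDiffAt_g hs hs).continuousAt
    have hφ := continuousAt_extChartAt (I := 𝓡 2) p
    constructor
    · simp only [angle, g_J₁_left, neg_sq]
      exact ((c₁.pow 2).add (c₂.pow 2)).comp hφ
    · exact (c₃.pow 2).comp hφ
  have hlt (p : M) : ∀ᶠ q in nhds p, q ∈ (extChartAt (𝓡 2) p).source :=
    extChartAt_source_mem_nhds p
  constructor
  -- Closed: a nonzero angle stays nonzero nearby.
  · rw [← isOpen_compl_iff, isOpen_iff_mem_nhds]
    intro p hp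
    have hp' := (P_image_subset_normalSpace_iff hF (mem_extChartAt_source (I := 𝓡 2) p)).not.1 hp
    filter_upwards [(hcont p).1.eventually_ne hp', hlt p] with q h₁ h₂
    exact (P_image_subset_normalSpace_iff hF h₂).not.2 h₁
  -- Open: where the angle is 0 it differs from g(ξ, ξ)² ≠ 0. This persists nearby and excludes the
  -- P-invariant alternative, which would force equality.
  · rw [isOpen_iff_mem_nhds]
    intro p hp
    have hp' := (P_image_subset_normalSpace_iff hF (mem_extChartAt_source (I := 𝓡 2) p)).1 hp
    have hg := pow_ne_zero 2 (g_frame_ne_zero hF (mem_extChartAt_source (I := 𝓡 2) p))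
    have hne : angle (frame (inChart F p) 0 (extChartAt (𝓡 2) p p)) -
        g 1 (frame (inChart F p) 0 (extChartAt (𝓡 2) p p))
          (frame (inChart F p) 0 (extChartAt (𝓡 2) p p)) ^ 2 ≠ 0 := by
      rw [hp', zero_sub]; exact neg_ne_zero.2 hg
    filter_upwards [((hcont p).1.sub (hcont p).2).eventually_ne hne, hlt p] with q h₁ h₂
    refine (P_image_subset_normalSpace_iff hF h₂).2 ((angle_dichotomy hF hgeo h₂).resolve_right ?_)
    exact fun h => h₁ (sub_eq_zero.2 (angle_eq_sq h))

end Manifold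

end NKSL

end

/-! ### The classification on a connected surface -/

theorem proposition4p1 {M : Type*} [TopologicalSpace M]
    [ChartedSpace (EuclideanSpace ℝ (Fin 2)) M] [IsManifold (𝓡 2) ∞ M] [ConnectedSpace M]
    (F : M → NKSL.SL × NKSL.SL) (hF : NKSL.IsAlmostComplexSurface F)
    (hgeo : NKSL.IsTotallyGeodesic F) :
    (∀ p : M, NKSL.P (F p) '' NKSL.tangentPlane F p ⊆ NKSL.normalSpace F p ∧
      NKSL.gaussianCurvature F p = -4 / 3) ∨
    (∀ p : M, NKSL.P (F p) '' NKSL.tangentPlane F p = NKSL.tangentPlane F p ∧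
      NKSL.P (F p) '' NKSL.normalSpace F p = NKSL.normalSpace F p ∧
      NKSL.gaussianCurvature F p = 0) := by
  rcases isClopen_iff.1 (NKSL.isClopen_normal_type hF hgeo) with h | h
  · right
    intro p
    have hp := mem_extChartAt_source (I := 𝓡 2) p
    have ha := mt (NKSL.P_image_subset_normalSpace_iff hF hp).2
      (Set.eq_empty_iff_forall_notMem.1 h p)
    have hm := (NKSL.angle_dichotomy hF hgeo hp).resolve_left ha
    have hT := NKSL.P_image_tangentPlane hF hp hm
    refine ⟨hT, NKSL.P_image_normalSpace hT, ?_⟩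
    rw [NKSL.gaussianCurvature_eq hF hgeo, NKSL.angle_eq_sq hm,
      div_self (pow_ne_zero 2 (NKSL.g_frame_ne_zero hF hp))]
    norm_num
  · left
    intro p
    have hp := mem_extChartAt_source (I := 𝓡 2) p
    have hN : p ∈ {q : M | NKSL.P (F q) '' NKSL.tangentPlane F q ⊆ NKSL.normalSpace F q} :=
      h ▸ Set.mem_univ p
    refine ⟨hN, ?_⟩
    rw [NKSL.gaussianCurvature_eq hF hgeo, (NKSL.P_image_subset_normalSpace_iff hF hp).1 hN]
    norm_num
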